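/- Let $K$ be a field of characteristic $0$ (for instance $\mathbb{C}$ or $\mathbb{R}$) and let $X \subset \mathbb{P}^N$ be an irreducible Zariski-closed subset of the projective space over $K$, of dimension $n < N$, with homogeneous ideal $I(X)$ of all polynomials vanishing on $X$. For a point $x \in X$ let $T_xX \subset \mathbb{P}^N$ be the projective tangent subspace defined by the differentials at $x$ of the elements of $I(X)$; $x$ is smooth if $\dim T_xX = n$. Let $r$ be the rank of the Gauss map $\gamma : x \mapsto T_xX$ (the rank of its differential at a general smooth point), suppose that the Gauss map is degenerate, i.e. $r < n$, and let $l = n - r$. Let $X^* \subset (\mathbb{P}^N)^*$ be the dual variety, the Zariski closure of the set of hyperplanes $\xi$ with $\xi \supseteq T_xX$ for some smooth point $x$ of $X$. Write $\hat T_x \subset K^{N+1}$ for the linear subspace whose projectivization is $T_xX$. At a smooth point $x$ the differential of $\gamma$ is a bilinear map $\hat T_x \times \hat T_x \to K^{N+1}/\hat T_x$; composing it with a linear form $\xi = (\xi_\alpha)$ on $K^{N+1}/\hat T_x$ (a hyperplane containing $T_xX$, if $\xi \ne 0$) gives the quadratic form $\Phi(\xi) = \xi_\alpha \Phi^\alpha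 = \xi_\alpha b^\alpha_{pq}\omega^p\omega^q$ belonging to the second fundamental form of $X$ at $x$. It is called nonsingular if $\det(\xi_\alpha b^\alpha_{pq}) \neq 0$, where $(\xi_\alpha b^\alpha_{pq})$ is the $r \times r$ matrix of $\Phi(\xi)$ on a complement in $\hat T_x$ of the kernel of the differential of $\gamma$ (in particular, this kernel has codimension $r$). Then $X$ is dually nondegenerate, that is, $\dim X^* = N - l - 1$, if and only if at a general smooth point $x$ of $X$ (every smooth point outside some hypersurface not containing $X$) there is at least one nonsingular quadratic form $\Phi(\xi)$ belonging to the second fundamental form of $X$ at $x$. Moreover, $X$ is dually nondegenerate as soon as there is such a form at one smooth point of $X$; that is, $\dim X^* = N - l - 1$ if and only if there is a smooth point $x$ of $X$ at which some form $\Phi(\xi)$ is nonsingular. -/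

import Mathlib

open MvPolynomial

namespace DualVar

/-- Homogeneous coordinate vectors of `ℙ^N` over `K`. -/
abbrev Vec (K : Type*) (N : ℕ) : Type _ := Fin (N + 1) → K

/-- The projective space `ℙ^N` over `K`. The dual space `(ℙ^N)^*` is also written in
coordinates: the point `ξ` stands for the hyperplane `∑ ξ_i x_i = 0`. -/
abbrev PSpace (K : Type*) [Field K] (N : ℕ) : Type _ := Projectivization K (Vec K N)

noncomputable section

variable {K : Type*} [Field K] {N : ℕ}

/-- All homogeneous coordinate vectors of all points of `X ⊆ ℙ^N`
(the affine cone over `X` without the origin). -/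
def coneOf (X : Set (PSpace K N)) : Set (Vec K N) :=
  {x | ∃ hx : x ≠ 0, Projectivization.mk K x hx ∈ X}

/-- The ideal `I(X)` of all polynomials that vanish on `X` (on all coordinate vectors of all of
its points). Over an infinite field it is a homogeneous ideal. -/
def idealOf (X : Set (PSpace K N)) : Ideal (MvPolynomial (Fin (N + 1)) K) :=
  MvPolynomial.vanishingIdeal K (coneOf X)

/-- The Zariski closure in `ℙ^N`. -/
def zariskiClosure (X : Set (PSpace K N)) : Set (PSpace K N) :=
  {p | ∀ f ∈ idealOf X, MvPolynomial.eval p.rep f = 0}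

/-- `X` is an irreducible Zariski-closed subset of `ℙ^N`. (Non-emptiness is included: the
ideal of the empty set is the unit ideal, which is not prime.) -/
structure IsVariety (X : Set (PSpace K N)) : Prop where
  closed : zariskiClosure X = X
  irreducible : (idealOf X).IsPrime

/-- The Krull dimension of the homogeneous coordinate ring of (the Zariski closure of) `X`;
this is the dimension of `X` plus one. -/
def coneDim (X : Set (PSpace K N)) : WithBot ℕ∞ :=
  ringKrullDim (MvPolynomial (Fin (N + 1)) K ⧸ idealOf X)

/-- `dim X = n`. -/
def HasDim (X : Set (PSpace K N)) (n : ℕ) : Prop :=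
  coneDim X = (n : WithBot ℕ∞) + 1

/-- The linear subspace of `K^(N+1)` whose projectivization is the tangent subspace `T_x X`,
where `x` is a coordinate vector of a point of `X`:
all `w` with `∑ w_i (∂f/∂x_i)(x) = 0` for every `f` in `I(X)`. -/
def tangentSpace (X : Set (PSpace K N)) (x : Vec K N) : Submodule K (Vec K N) where
  carrier := {w | ∀ f ∈ idealOf X, ∑ i, w i * eval x (pderiv i f) = 0}
  zero_mem' := by intro f _; simp
  add_mem' := by
    intro a b ha hb f hf
    simp [add_mul, Finset.sum_add_distrib, ha f hf, hb f hf]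
  smul_mem' := by
    intro c a ha f hf
    simp [mul_assoc, ← Finset.mul_sum, ha f hf]

/-- (Coordinate vectors of) the smooth points of `X`: those at which the projective tangent
subspace has the same dimension as `X`. -/
def smoothLocus (X : Set (PSpace K N)) : Set (Vec K N) :=
  {x | x ∈ coneOf X ∧ (Module.finrank K (tangentSpace X x) : WithBot ℕ∞) = coneDim X}

/-- The set `X^∧` of the hyperplanes that are tangent to `X` at some smooth point. -/
def tangentHyperplanes (X : Set (PSpace K N)) : Set (PSpace K N) :=
  {ξ | ∃ x ∈ smoothLocus X, ∀ w ∈ tangentSpace X x, ξ.rep ⬝ᵥ w = 0}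

/-- The dual variety `X^*`, the closure of `X^∧`. -/
def dualVariety (X : Set (PSpace K N)) : Set (PSpace K N) :=
  zariskiClosure (tangentHyperplanes X)

/-- The value at `x` of a polynomial vector field `W` on `K^(N+1)`. -/
def fieldValue (W : Fin (N + 1) → MvPolynomial (Fin (N + 1)) K) (x : Vec K N) : Vec K N :=
  fun i => eval x (W i)

/-- The derivative of the vector field `W` at `x` in the direction `v`. -/
def fieldDeriv (W : Fin (N + 1) → MvPolynomial (Fin (N + 1)) K) (x v : Vec K N) : Vec K N :=
  fun i => ∑ j, v j * eval x (pderiv j (W i))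

/-- `B` is the differential at `x` of the Gauss map `γ : y ↦ T_y X`, as a linear map
`T_x → Hom(T_x, K^(N+1) / T_x)`, where the target is the tangent space of the Grassmannian
at `T_x`: for each moving vector `W` with `W(y) ∈ T_y X` for all `y`, it sends `v` to the linear
map `W(x) ↦ dW_x(v) mod T_x`. In terms of moving frames, if the `A_p` are tangent fields then
`dA_p ≡ ω_p^α A_α mod T_x`, and the `ω_p^α` are the components of `B`. -/
def IsGaussDifferential (X : Set (PSpace K N)) (x : Vec K N)
    (B : tangentSpace X x →ₗ[K] tangentSpace X x →ₗ[K] (Vec K N ⧸ tangentSpace X x)) : Prop :=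
  ∀ (W : Fin (N + 1) → MvPolynomial (Fin (N + 1)) K)
    (hx : fieldValue W x ∈ tangentSpace X x),
    (∀ y ∈ coneOf X, fieldValue W y ∈ tangentSpace X y) →
      ∀ v : tangentSpace X x,
        B v ⟨fieldValue W x, hx⟩ = Submodule.Quotient.mk (fieldDeriv W x (v : Vec K N))

open Classical in
/-- The differential of the Gauss map at `x`. As a bilinear map on `T_x` with values in
`K^(N+1) / T_x` it is the second fundamental tensor of `X` at `x`. (At a smooth point there is
exactly one `B` as above; the value at other points is not used.) -/
def gaussDifferential (X : Set (PSpace K N)) (x : Vec K N) :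
    tangentSpace X x →ₗ[K] tangentSpace X x →ₗ[K] (Vec K N ⧸ tangentSpace X x) :=
  if h : ∃ B, IsGaussDifferential X x B then h.choose else 0

/-- The rank of the Gauss map of `X`: the rank of its differential at a general smooth point,
which is the largest rank at a smooth point. -/
def gaussRank (X : Set (PSpace K N)) : ℕ :=
  sSup {k | ∃ x ∈ smoothLocus X, k = Module.finrank K (LinearMap.range (gaussDifferential X x))}

/-- The form `Φ(ξ) = ξ_α Φ^α` of the second fundamental form of `X` at `x` that belongs to the
hyperplane `ξ` through `T_x` (a linear form on `K^(N+1) / T_x`), as a bilinear form on `T_x`. -/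
def secondFundamentalForm (X : Set (PSpace K N)) (x : Vec K N)
    (ξ : Module.Dual K (Vec K N ⧸ tangentSpace X x)) :
    LinearMap.BilinForm K (tangentSpace X x) :=
  (gaussDifferential X x).compr₂ ξ

/-- The form `Φ(ξ)` at `x` is nonsingular: `det (ξ_α b^α_{pq}) ≠ 0` for its `r × r` matrix with
respect to vectors `A_1, …, A_r` of `T_x`, where `r` is the rank of the Gauss map of `X`, that
span a complement of the directions in which the tangent subspace is stationary (the kernel of
the differential of the Gauss map). -/
def IsNonsingularAt (X : Set (PSpace K N)) (x : Vec K N)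
    (ξ : Module.Dual K (Vec K N ⧸ tangentSpace X x)) : Prop :=
  ∃ A : Fin (gaussRank X) → tangentSpace X x,
    IsCompl (Submodule.span K (Set.range A)) (LinearMap.ker (gaussDifferential X x)) ∧
      (Matrix.of fun p q => secondFundamentalForm X x ξ (A p) (A q)).det ≠ 0

/-- The property `P` holds at a general smooth point of `X`: it holds at each smooth point
outside some hypersurface `g = 0` that does not contain `X`. -/
def ForGeneralSmoothPoint (X : Set (PSpace K N)) (P : Vec K N → Prop) : Prop :=
  ∃ (d : ℕ) (g : MvPolynomial (Fin (N + 1)) K), g.IsHomogeneous d ∧ g ∉ idealOf X ∧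
    ∀ x ∈ smoothLocus X, eval x g ≠ 0 → P x

end

end DualVar

/-! ### Krull dimension as transcendence degree. -/

section KrullDimension

/-! Let `f_1, …, f_m` generate `I(X)` and send `(x, μ)`, with `x` in the cone over `X` and `μ ∈
𝔸^m`, to the covector `∑ μ_a df_a(x)`. For fixed `x` these are exactly the covectors that vanish on
`T_x`, so the image over the smooth points is dense in the cone over `X^*` (`idealOf_dualVariety`).
In characteristic `0` the dimension `e` of this cone is the rank of the map at the generic point:
the dimension of the space of all `H v + Jᵀ ν` with `J v = 0`, where `J` is the Jacobian matrix of
the `f_a` and `H` the Hessian of `∑ μ_a f_a`. Derivations of the function field serve as tangent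
vectors (`ringKrullDim_quotient_ker_aeval`, `exists_derivation`).

One matrix carries this number: the bordered Hessian with blocks `H, Jᵀ, J, 0`. Its generic rank is
`c + e`, where `c = N - n` is the generic rank of `J` (`exists_ringKrullDim_eq_rank`); at a smooth
point its rank is `2c + rank (H|T_x)` (`rank_borderedHessian_map_evalPoint`). Rank cannot grow under
specialization and is preserved outside a hypersurface, so `e - c` is the largest rank of `H|T_x`.

Differentiating `dF(W) = 0` for tangent fields `W` gives `H|T_x = -Φ(ξ)` with `ξ = dF(x)`
(`secondFundamentalForm_eq`). Since `Φ(ξ)` factors through the Gauss differential, its rank is at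
most `r`, and it is `r` exactly when `Φ(ξ)` is nonsingular. Hence `e ≤ c + r = N - l`, with equality
if and only if a nonsingular form exists at one smooth point, equivalently at a general one. -/

theorem ringKrullDim_eq_of_isIntegral_of_injective {R S : Type*} [CommRing R] [CommRing S]
    [Algebra R S] [Algebra.IsIntegral R S] (hinj : Function.Injective (algebraMap R S)) :
    ringKrullDim S = ringKrullDim R := by
  apply le_antisymm
  · refine Order.krullDim_le_of_strictMono (PrimeSpectrum.comap (algebraMap R S)) ?_
    intro p q hpq
    exact Ideal.IsIntegral.comap_lt_comap (R := R) hpq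
  · have : FaithfulSMul R S := (faithfulSMul_iff_algebraMap_injective R S).2 hinj
    refine iSup_le fun p => ?_
    obtain ⟨Q, hQ⟩ := Ideal.nonempty_primesOver (S := S) p.head.asIdeal
    have := hQ.1
    have := hQ.2
    obtain ⟨q, hq, -⟩ := Ideal.exists_ltSeries_of_hasGoingUp p Q
    rw [← hq]
    exact Order.LTSeries.length_le_krullDim q

/-- By Noether normalization `A` is integral over a polynomial ring in `s` variables, and both sides
equal `s`. -/
theorem ringKrullDim_eq_trdeg {k A : Type*} [Field k] [CommRing A] [IsDomain A] [Algebra k A]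
    [Algebra.FiniteType k A] : ringKrullDim A = ((Algebra.trdeg k A).toNat : WithBot ℕ∞) := by
  obtain ⟨s, g, hg, hgi⟩ := exists_integral_inj_algHom_of_fg k A
  let := g.toRingHom.toAlgebra
  have : IsScalarTower k (MvPolynomial (Fin s) k) A :=
    IsScalarTower.of_algebraMap_eq fun x => (g.commutes x).symm
  have : Algebra.IsIntegral (MvPolynomial (Fin s) k) A := ⟨hgi⟩
  have hinj : Function.Injective (algebraMap (MvPolynomial (Fin s) k) A) := hg
  have : FaithfulSMul (MvPolynomial (Fin s) k) A :=
    (faithfulSMul_iff_algebraMap_injective _ _).2 hinj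
  have hb := (IsTranscendenceBasis.mvPolynomial (Fin s) k).algebraMap_comp (A := A)
  have hc := hb.lift_cardinalMk_eq_trdeg
  have : (Algebra.trdeg k A).toNat = s := by
    have := congrArg Cardinal.toNat hc
    simpa using this.symm
  rw [ringKrullDim_eq_of_isIntegral_of_injective hinj,
    MvPolynomial.ringKrullDim_of_isNoetherianRing, this]
  simp

end KrullDimension

/-! ### Derivations of a function field as tangent vectors. -/

section Derivations

variable {K L : Type*} [Field K] [Field L] [Algebra K L]

theorem Algebra.FormallySmooth.exists_ringHom_lift {A L B : Type*} [CommRing A] [CommRing L]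
    [CommRing B] [Algebra A L] [Algebra.FormallySmooth A L] (g : B →+* L)
    (hg : Function.Surjective g) (hker : IsNilpotent (RingHom.ker g)) (φ : A →+* B)
    (hφ : ∀ a, g (φ a) = algebraMap A L a) :
    ∃ ψ : L →+* B, (∀ x, g (ψ x) = x) ∧ ∀ a, ψ (algebraMap A L a) = φ a := by
  let := φ.toAlgebra
  let g' : B →ₐ[A] L := { g with commutes' := hφ }
  refine ⟨(Algebra.FormallySmooth.liftOfSurjective (AlgHom.id A L) g' hg hker).toRingHom, ?_, ?_⟩
  · exact fun x => Algebra.FormallySmooth.liftOfSurjective_apply (AlgHom.id A L) g' hg hker x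
  · exact fun a => (Algebra.FormallySmooth.liftOfSurjective (AlgHom.id A L) g' hg hker).commutes a

/-- A derivation is the `ε`-part of a ring homomorphism into the dual numbers. The kernel of `L[ε] →
L` has square zero, so formal smoothness extends `φ` from `A` to `L`. -/
theorem Derivation.exists_of_ringHom_trivSqZeroExt {A : Type*} [CommRing A]
    [Algebra K A] [Algebra A L] [IsScalarTower K A L] [Algebra.FormallySmooth A L]
    (φ : A →+* TrivSqZeroExt L L) (hφ : ∀ a, (φ a).fst = algebraMap A L a)
    (hK : ∀ c : K, (φ (algebraMap K A c)).snd = 0) :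
    ∃ D : Derivation K L L, ∀ a, D (algebraMap A L a) = (φ a).snd := by
  let g : TrivSqZeroExt L L →+* L := (TrivSqZeroExt.fstHom L L L).toRingHom
  have hgs : Function.Surjective g := fun x => ⟨TrivSqZeroExt.inl x, rfl⟩
  have hker : IsNilpotent (RingHom.ker g) := by
    refine ⟨2, ?_⟩
    change RingHom.ker g ^ 2 = ⊥
    rw [sq (RingHom.ker g), eq_bot_iff, Ideal.mul_le]
    intro r hr s hs
    have hr' : r.fst = 0 := hr
    have hs' : s.fst = 0 := hs
    rw [Ideal.mem_bot]
    ext <;> simp [hr', hs']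
  obtain ⟨ψ, h1, h2⟩ := Algebra.FormallySmooth.exists_ringHom_lift g hgs hker φ hφ
  have h1' : ∀ x, (ψ x).fst = x := h1
  have hψK : ∀ c : K, (ψ (algebraMap K L c)).snd = 0 := fun c => by
    rw [IsScalarTower.algebraMap_apply K A L, h2, hK]
  let D : L →ₗ[K] L :=
    { toFun := fun x => (ψ x).snd
      map_add' := fun x y => by simp
      map_smul' := fun c x => by simp [Algebra.smul_def, hψK, h1'] }
  refine ⟨Derivation.mk' D fun a b => ?_, fun a => ?_⟩
  · simp [D, h1', mul_comm]
  · simp [D, h2]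

/-- Evaluation of derivations of `L` on a family of elements of `L`. -/
def Derivation.evalFamily (K : Type*) {L ι : Type*} [Field K] [Field L] [Algebra K L] (y : ι → L) :
    Derivation K L L →ₗ[L] (ι → L) where
  toFun D i := D (y i)
  map_add' _ _ := rfl
  map_smul' _ _ := rfl

/-- The field of constants of a derivation. -/
def Derivation.constants (D : Derivation K L L) : IntermediateField K L where
  carrier := {z | D z = 0}
  mul_mem' {a b} ha hb := by
    simp only [Set.mem_ofPred_eq] at *
    simp [ha, hb]
  add_mem' {a b} ha hb := by
    simp only [Set.mem_ofPred_eq] at *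
    simp [ha, hb]
  algebraMap_mem' c := by simp
  inv_mem' a ha := by
    simp only [Set.mem_ofPred_eq] at *
    simp [D.leibniz_inv, ha]

/-- Applying `D` to `p(z) = 0`, with `p` the minimal polynomial over the constants, gives `p'(z) D z
= 0`; in characteristic `0`, `p` is separable and `p'(z) ≠ 0`. -/
theorem Derivation.eq_zero_of_isAlgebraic_constants [CharZero K] (D : Derivation K L L) (z : L)
    (hz : IsAlgebraic D.constants z) : D z = 0 := by
  have hzero : ∀ c : D.constants, D (c : L) = 0 := fun c => c.2
  let D' : Derivation D.constants L L := Derivation.mk'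
    { toFun := D
      map_add' := D.map_add
      map_smul' := fun c x => by
        simp only [Algebra.smul_def, IntermediateField.algebraMap_apply, D.leibniz, hzero]
        simp }
    fun a b => by simp
  have hi : IsIntegral D.constants z := hz.isIntegral
  have : CharZero D.constants := charZero_of_injective_algebraMap (algebraMap K _).injective
  have hsep : (minpoly D.constants z).Separable := (minpoly.irreducible hi).separable
  have h := D'.map_aeval (minpoly D.constants z) z
  rw [minpoly.aeval, map_zero, smul_eq_mul] at h
  exact (mul_eq_zero.1 h.symm).resolve_left
    (hsep.aeval_derivative_ne_zero (minpoly.aeval _ _))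

theorem MvPolynomial.snd_aeval_trivSqZeroExt {σ : Type*} [Fintype σ] (x v : σ → L)
    (f : MvPolynomial σ K) :
    (aeval (fun i => (TrivSqZeroExt.inl (x i) + TrivSqZeroExt.inr (v i) : TrivSqZeroExt L L)) f).fst
        = aeval x f ∧
    (aeval (fun i => (TrivSqZeroExt.inl (x i) + TrivSqZeroExt.inr (v i) : TrivSqZeroExt L L)) f).snd
        = ∑ i, v i * aeval x (pderiv i f) := by
  classical
  set e : σ → TrivSqZeroExt L L := fun i => TrivSqZeroExt.inl (x i) + TrivSqZeroExt.inr (v i)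
    with he
  have h1 : ∀ i, (e i).fst = x i := fun i => by simp [he]
  have h2 : ∀ i, (e i).snd = v i := fun i => by simp [he]
  clear_value e
  induction f using MvPolynomial.induction_on with
  | C a => simp [TrivSqZeroExt.algebraMap_eq_inl']
  | add p q hp hq => simp [hp, hq, mul_add, Finset.sum_add_distrib]
  | mul_X p i hp =>
    have hs : ∀ j, v j * aeval x (pderiv j (p * X i)) =
        x i * (v j * aeval x (pderiv j p)) + (if i = j then v j * aeval x p else 0) := fun j => by
      by_cases h : i = j
      · subst h; simp; ring
      · simp [pderiv_X, h]; ring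
    refine ⟨by simp [hp, h1], ?_⟩
    simp only [hs, Finset.sum_add_distrib, ← Finset.mul_sum, Finset.sum_ite_eq, Finset.mem_univ,
      if_true, map_mul, aeval_X, TrivSqZeroExt.snd_mul, h1, h2, hp]
    simp
    ring

/-- In characteristic `0`, `L` is formally smooth over `K(w)`, which is a localization of a
polynomial ring; hence values chosen freely on the variables extend to `L`. -/
theorem Derivation.exists_of_algebraicIndependent [CharZero K] [Algebra.EssFiniteType K L]
    {τ : Type*} [Fintype τ] {w : τ → L} (hw : AlgebraicIndependent K w) (u : τ → L) :
    ∃ D : Derivation K L L, ∀ b, D (w b) = u b := by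
  let := (aeval w : MvPolynomial τ K →ₐ[K] L).toRingHom.toAlgebra
  have : IsScalarTower K (MvPolynomial τ K) L :=
    IsScalarTower.of_algebraMap_eq fun x => ((aeval w).commutes x).symm
  have : FaithfulSMul (MvPolynomial τ K) L := (faithfulSMul_iff_algebraMap_injective _ _).2 hw
  let := FractionRing.liftAlgebra (MvPolynomial τ K) L
  have : IsScalarTower (MvPolynomial τ K) (FractionRing (MvPolynomial τ K)) L :=
    FractionRing.isScalarTower_liftAlgebra _ _
  have : IsScalarTower K (FractionRing (MvPolynomial τ K)) L := by
    refine IsScalarTower.of_algebraMap_eq fun x => ?_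
    rw [IsScalarTower.algebraMap_apply K (MvPolynomial τ K) (FractionRing (MvPolynomial τ K)),
      ← IsScalarTower.algebraMap_apply (MvPolynomial τ K) (FractionRing (MvPolynomial τ K)) L,
      ← IsScalarTower.algebraMap_apply]
  have : CharZero (FractionRing (MvPolynomial τ K)) :=
    charZero_of_injective_algebraMap (algebraMap K _).injective
  have : Algebra.EssFiniteType (FractionRing (MvPolynomial τ K)) L := .of_comp K _ _
  have : Algebra.FormallySmooth (MvPolynomial τ K) (FractionRing (MvPolynomial τ K)) :=
    .of_isLocalization (nonZeroDivisors _)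
  have : Algebra.FormallySmooth (MvPolynomial τ K) L :=
    .comp _ (FractionRing (MvPolynomial τ K)) _
  obtain ⟨D, hD⟩ := Derivation.exists_of_ringHom_trivSqZeroExt (K := K) (L := L)
    (aeval (R := K) (fun i => (TrivSqZeroExt.inl (w i) + TrivSqZeroExt.inr (u i) :
      TrivSqZeroExt L L))).toRingHom
    (fun a => (MvPolynomial.snd_aeval_trivSqZeroExt w u a).1)
    (fun c => by simp [MvPolynomial.algebraMap_eq, TrivSqZeroExt.algebraMap_eq_inl'])
  refine ⟨D, fun b => ?_⟩
  have h := hD (X b)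
  have hX : algebraMap (MvPolynomial τ K) L (X b) = w b := aeval_X w b
  rw [hX] at h
  rw [h]
  simp

/-- Dimension as rank of a differential. Choose a transcendence basis among the `y i`: the values of
a derivation there are arbitrary, and they determine its values on all `y i`. -/
theorem ringKrullDim_quotient_ker_aeval [CharZero K] [Algebra.EssFiniteType K L] {ι : Type*}
    [Finite ι] (y : ι → L) :
    ringKrullDim (MvPolynomial ι K ⧸ RingHom.ker (aeval y : MvPolynomial ι K →ₐ[K] L)) =
      (Module.finrank L (LinearMap.range (Derivation.evalFamily K y)) : WithBot ℕ∞) := by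
  classical
  let A := (aeval y : MvPolynomial ι K →ₐ[K] L).range
  let y' : ι → A := fun i => ⟨y i, X i, aeval_X y i⟩
  let e : (MvPolynomial ι K ⧸ RingHom.ker (aeval y : MvPolynomial ι K →ₐ[K] L)) ≃ₐ[K] A :=
    Ideal.quotientKerEquivRange (aeval y : MvPolynomial ι K →ₐ[K] L)
  have hy' : Algebra.adjoin K (Set.range y') = ⊤ := by
    rw [Algebra.adjoin_range_eq_range_aeval, eq_top_iff]
    rintro ⟨z, hz⟩ -
    obtain ⟨p, hp⟩ := id hz
    refine ⟨p, Subtype.ext ?_⟩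
    change A.val (aeval y' p) = z
    rw [← AlgHom.comp_apply, comp_aeval]
    exact hp
  have : Algebra.FiniteType K A := ⟨⟨(Set.finite_range y').toFinset, by simpa using hy'⟩⟩
  have : Algebra.IsAlgebraic (Algebra.adjoin K (Set.range y')) A :=
    ⟨fun a => isAlgebraic_algebraMap (⟨a, hy' ▸ Algebra.mem_top⟩ : Algebra.adjoin K (Set.range y'))⟩
  obtain ⟨t, hts, ht⟩ := exists_isTranscendenceBasis_subset (R := K) (A := A) (Set.range y')
  have : Finite t := (Set.finite_range y').subset hts
  have : Fintype t := Fintype.ofFinite t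
  choose idx hidx using fun b : t => hts b.2
  let w : t → L := fun b => ((b : A) : L)
  have hw : AlgebraicIndependent K w :=
    ht.1.map' (f := A.val) Subtype.val_injective
  have hyw : ∀ b, y (idx b) = w b := fun b => congrArg Subtype.val (hidx b)
  have hcard : (Algebra.trdeg K A).toNat = Fintype.card t := by
    have := congrArg Cardinal.toNat ht.lift_cardinalMk_eq_trdeg
    simpa using this.symm
  rw [ringKrullDim_eq_of_ringEquiv e.toRingEquiv, ringKrullDim_eq_trdeg (k := K), hcard]
  let π : LinearMap.range (Derivation.evalFamily K y) →ₗ[L] (t → L) :=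
    (LinearMap.funLeft L L idx).domRestrict _
  have hπ : Function.Bijective π := by
    constructor
    · rw [injective_iff_map_eq_zero]
      rintro ⟨_, D, rfl⟩ hD
      have hD0 : ∀ b, D (w b) = 0 := fun b => by
        rw [← hyw]; exact congrFun hD b
      refine Subtype.ext (funext fun i => ?_)
      refine D.eq_zero_of_isAlgebraic_constants _ ?_
      have hle : Algebra.adjoin K (Set.range ((↑) : t → A)) ≤
          D.constants.toSubalgebra.comap A.val := by
        refine Algebra.adjoin_le ?_
        rintro _ ⟨b, rfl⟩
        exact hD0 b
      exact (ht.isAlgebraic.isAlgebraic (y' i)).ringHom_of_comp_eq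
        (f := (A.val.toRingHom.comp
          (Algebra.adjoin K (Set.range ((↑) : t → A))).val.toRingHom).codRestrict D.constants.toSubfield
            fun z => hle z.2)
        (g := A.val.toRingHom)
        (fun a b hab => by
          have h := congrArg Subtype.val hab
          exact Subtype.ext (Subtype.ext h)) (by ext; rfl)
    · intro u
      obtain ⟨D, hD⟩ := Derivation.exists_of_algebraicIndependent hw u
      refine ⟨⟨_, D, rfl⟩, funext fun b => ?_⟩
      rw [← hD b, ← hyw]
      rfl
  rw [(LinearEquiv.ofBijective π hπ).finrank_eq, Module.finrank_fintype_fun_eq_card]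

/-- An `L`-valued tangent vector `(v, μ)` of `V(I) × 𝔸^τ` is the homomorphism `x ↦ x + ε v` into the
dual numbers, and `hv` says that it kills `I`. -/
theorem Derivation.exists_of_mvPolynomial_quotient {σ τ : Type*} [Fintype σ]
    (I : Ideal (MvPolynomial σ K)) [Algebra (MvPolynomial τ (MvPolynomial σ K ⧸ I)) L]
    [IsScalarTower K (MvPolynomial τ (MvPolynomial σ K ⧸ I)) L]
    [Algebra.FormallySmooth (MvPolynomial τ (MvPolynomial σ K ⧸ I)) L]
    (v : σ → L) (μ : τ → L)
    (hv : ∀ f ∈ I, ∑ i, v i * algebraMap (MvPolynomial τ (MvPolynomial σ K ⧸ I)) L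
      (C (Ideal.Quotient.mk I (pderiv i f))) = 0) :
    ∃ D : Derivation K L L,
      (∀ i, D (algebraMap (MvPolynomial τ (MvPolynomial σ K ⧸ I)) L
        (C (Ideal.Quotient.mk I (X i)))) = v i) ∧
      ∀ a, D (algebraMap (MvPolynomial τ (MvPolynomial σ K ⧸ I)) L (X a)) = μ a := by
  let S := MvPolynomial τ (MvPolynomial σ K ⧸ I)
  let ι : MvPolynomial σ K →ₐ[K] L := (IsScalarTower.toAlgHom K S L).comp
    ((IsScalarTower.toAlgHom K (MvPolynomial σ K ⧸ I) S).comp (Ideal.Quotient.mkₐ K I))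
  have hι : ∀ f, ι f = algebraMap S L (C (Ideal.Quotient.mk I f)) := fun f => rfl
  let x : σ → L := fun i => ι (X i)
  have hx : aeval x = ι := by ext i; simp [x]
  let φ₀ : MvPolynomial σ K →ₐ[K] TrivSqZeroExt L L :=
    aeval fun i => TrivSqZeroExt.inl (x i) + TrivSqZeroExt.inr (v i)
  have h₁ : ∀ f, (φ₀ f).fst = ι f := fun f => by
    rw [← hx]; exact (MvPolynomial.snd_aeval_trivSqZeroExt x v f).1
  have h₂ : ∀ f, (φ₀ f).snd = ∑ i, v i * ι (pderiv i f) := fun f => by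
    rw [← hx]; exact (MvPolynomial.snd_aeval_trivSqZeroExt x v f).2
  let φ₁ : MvPolynomial σ K ⧸ I →+* TrivSqZeroExt L L := Ideal.Quotient.lift I φ₀.toRingHom
    fun f hf => by
      refine TrivSqZeroExt.ext ((h₁ f).trans ?_) ((h₂ f).trans (hv f hf))
      rw [hι, Ideal.Quotient.eq_zero_iff_mem.2 hf]
      simp
  have hφ₁ : ∀ f, φ₁ (Ideal.Quotient.mk I f) = φ₀ f := fun f => rfl
  let φ : S →+* TrivSqZeroExt L L := eval₂Hom φ₁ fun a =>
    TrivSqZeroExt.inl (algebraMap S L (X a)) + TrivSqZeroExt.inr (μ a)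
  have hφC : ∀ f, φ (C (Ideal.Quotient.mk I f)) = φ₀ f := fun f =>
    (eval₂Hom_C _ _ _).trans (hφ₁ f)
  have hφX : ∀ a, φ (X a) = TrivSqZeroExt.inl (algebraMap S L (X a)) + TrivSqZeroExt.inr (μ a) :=
    fun a => eval₂Hom_X' _ _ _
  have hfst : (TrivSqZeroExt.fstHom L L L).toRingHom.comp φ = algebraMap S L := by
    refine MvPolynomial.ringHom_ext ?_ fun a => ?_
    · intro q
      obtain ⟨f, rfl⟩ := Ideal.Quotient.mk_surjective q
      change (φ _).fst = _
      rw [hφC, h₁, hι]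
    · change (φ _).fst = _
      rw [hφX]
      simp
  have hfst' : ∀ a : S, (φ a).fst = algebraMap S L a := fun a => RingHom.congr_fun hfst a
  obtain ⟨D, hD⟩ := Derivation.exists_of_ringHom_trivSqZeroExt (K := K) (A := S) (L := L) φ hfst'
    (fun c => by
      change (φ (C (Ideal.Quotient.mk I (C c)))).snd = 0
      rw [hφC, h₂]
      simp)
  refine ⟨D, fun i => ?_, fun a => ?_⟩
  · rw [hD, hφC]
    simp [φ₀]
  · rw [hD, hφX]
    simp

end Derivations

/-! ### Ranks of bordered matrices; minors and specialization. -/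

section LinearAlgebra

theorem LinearMap.finrank_range_prod {F V A B : Type*} [Field F] [AddCommGroup V] [Module F V]
    [AddCommGroup A] [Module F A] [AddCommGroup B] [Module F B] [FiniteDimensional F V]
    (f : V →ₗ[F] A) (g : V →ₗ[F] B) :
    Module.finrank F (range (f.prod g)) =
      Module.finrank F (range g) + Module.finrank F ((ker g).map f) := by
  have h1 := (f.prod g).finrank_range_add_finrank_ker
  have h2 := g.finrank_range_add_finrank_ker
  have h3 := (f.domRestrict (ker g)).finrank_range_add_finrank_ker
  have h4 : range (f.domRestrict (ker g)) = (ker g).map f := by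
    rw [LinearMap.range_domRestrict]
  have h5 : Module.finrank F (ker (f.domRestrict (ker g))) =
      Module.finrank F (ker (f.prod g)) := by
    have : (ker f).comap (ker g).subtype = (ker f ⊓ ker g).comap (ker g).subtype := by
      ext x
      simp
    rw [LinearMap.ker_prod, LinearMap.ker_domRestrict, this]
    exact (Submodule.comapSubtypeEquivOfLe inf_le_right).finrank_eq
  rw [h4] at h3
  omega

namespace Matrix

variable {F m n : Type*} [Field F] [Fintype m] [Fintype n]

theorem exists_transpose_mulVec_eq (J : Matrix m n F) (w : n → F)
    (hw : ∀ u, J *ᵥ u = 0 → w ⬝ᵥ u = 0) : ∃ μ, Jᵀ *ᵥ μ = w := by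
  classical
  have hmem : dotProductBilin F F w ∈ (LinearMap.ker J.mulVecLin).dualAnnihilator := by
    rw [Submodule.mem_dualAnnihilator]
    exact fun u hu => hw u hu
  rw [← LinearMap.range_dualMap_eq_dualAnnihilator_ker] at hmem
  obtain ⟨φ, hφ⟩ := hmem
  refine ⟨fun a => φ (Pi.single a 1), funext fun i => ?_⟩
  have h := LinearMap.congr_fun hφ (Pi.single i 1)
  have hsum : J *ᵥ Pi.single i 1 = ∑ a, J a i • (Pi.single a 1 : m → F) := by
    rw [mulVec_single_one]
    exact pi_eq_sum_univ' _
  have h' : φ (J *ᵥ Pi.single i 1) = w i := by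
    refine h.trans ?_
    simp
  rw [← h', hsum]
  simp [mulVec, dotProduct]

/-- The lower blocks contribute the rank of `(v, μ) ↦ J v`; the rest is the image of its kernel
under the upper blocks. -/
theorem rank_fromBlocks_transpose (H : Matrix n n F) (J : Matrix m n F) :
    (fromBlocks H Jᵀ J 0).rank = J.rank + Module.finrank F
      ((LinearMap.ker (J.mulVecLin.comp (LinearMap.fst F (n → F) (m → F)))).map
        (H.mulVecLin.coprod Jᵀ.mulVecLin)) := by
  let g := J.mulVecLin.comp (LinearMap.fst F (n → F) (m → F))
  let f := H.mulVecLin.coprod Jᵀ.mulVecLin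
  have hfg : (LinearEquiv.sumArrowLequivProdArrow n m F F).toLinearMap.comp
      (fromBlocks H Jᵀ J 0).mulVecLin =
      (f.prod g).comp (LinearEquiv.sumArrowLequivProdArrow n m F F).toLinearMap := by
    refine LinearMap.ext fun z => ?_
    have hz : (fromBlocks H Jᵀ J 0) *ᵥ z =
        Sum.elim (H *ᵥ (z ∘ Sum.inl) + Jᵀ *ᵥ (z ∘ Sum.inr)) (J *ᵥ (z ∘ Sum.inl)) := by
      rw [fromBlocks_mulVec, zero_mulVec, add_zero]
    change LinearEquiv.sumArrowLequivProdArrow n m F F ((fromBlocks H Jᵀ J 0) *ᵥ z) = _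
    rw [hz]
    rfl
  have hr : LinearMap.range (J.mulVecLin.comp (LinearMap.fst F (n → F) (m → F))) =
      LinearMap.range J.mulVecLin :=
    LinearMap.range_comp_of_range_eq_top _ (LinearMap.range_eq_top.2 Prod.fst_surjective)
  have h := LinearMap.finrank_range_prod f g
  rw [Matrix.rank, Matrix.rank, ← hr, ← h,
    ← LinearEquiv.finrank_map_eq (LinearEquiv.sumArrowLequivProdArrow n m F F),
    ← LinearMap.range_comp, hfg, LinearMap.range_comp_of_range_eq_top _ (LinearEquiv.range _)]

/-- Restriction of covectors to `T = ker J` has kernel `range Jᵀ`, which lies inside the space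
measured here, and it maps that space onto the range of `B`. -/
theorem finrank_map_coprod_transpose (H : Matrix n n F) (J : Matrix m n F)
    (T : Submodule F (n → F)) (hT : ∀ v, v ∈ T ↔ J *ᵥ v = 0) (B : T →ₗ[F] T →ₗ[F] F)
    (hB : ∀ v u : T, B v u = (H *ᵥ (v : n → F)) ⬝ᵥ (u : n → F)) :
    Module.finrank F ((LinearMap.ker (J.mulVecLin.comp (LinearMap.fst F (n → F) (m → F)))).map
        (H.mulVecLin.coprod Jᵀ.mulVecLin)) = J.rank + Module.finrank F (LinearMap.range B) := by
  set W := (LinearMap.ker (J.mulVecLin.comp (LinearMap.fst F (n → F) (m → F)))).map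
        (H.mulVecLin.coprod Jᵀ.mulVecLin) with hW
  let ρ : (n → F) →ₗ[F] T →ₗ[F] F := (dotProductBilin F F).compl₂ T.subtype
  have hρ : ∀ w u, ρ w u = w ⬝ᵥ (u : n → F) := fun w u => rfl
  have hdot : ∀ μ (u : T), (Jᵀ *ᵥ μ) ⬝ᵥ (u : n → F) = 0 := fun μ u => by
    rw [mulVec_transpose, ← dotProduct_mulVec, (hT u).1 u.2, dotProduct_zero]
  have hker : LinearMap.ker ρ = LinearMap.range Jᵀ.mulVecLin := by
    ext w
    constructor
    · intro hw
      obtain ⟨μ, hμ⟩ := exists_transpose_mulVec_eq J w fun u hu =>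
        LinearMap.congr_fun hw ⟨u, (hT u).2 hu⟩
      exact ⟨μ, hμ⟩
    · rintro ⟨μ, rfl⟩
      exact LinearMap.ext fun u => hdot μ u
  have hle : LinearMap.ker ρ ≤ W := by
    rw [hker]
    rintro _ ⟨μ, rfl⟩
    exact ⟨(0, μ), by simp, by simp⟩
  have hmap : LinearMap.range (ρ.domRestrict W) = LinearMap.range B := by
    rw [LinearMap.range_domRestrict]
    ext φ
    constructor
    · rintro ⟨_, ⟨⟨v, μ⟩, hv, rfl⟩, rfl⟩
      refine ⟨⟨v, (hT v).2 hv⟩, LinearMap.ext fun u => ?_⟩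
      rw [hB, hρ]
      change _ = (H *ᵥ v + Jᵀ *ᵥ μ) ⬝ᵥ (u : n → F)
      rw [add_dotProduct, hdot, add_zero]
    · rintro ⟨v, rfl⟩
      refine ⟨H *ᵥ (v : n → F), ⟨((v : n → F), 0), (hT v).1 v.2, by simp⟩, LinearMap.ext fun u => ?_⟩
      rw [hB, hρ]
  have h := (ρ.domRestrict W).finrank_range_add_finrank_ker
  rw [hmap, LinearMap.ker_domRestrict, (Submodule.comapSubtypeEquivOfLe hle).finrank_eq, hker] at h
  rw [← h, add_comm, ← rank_transpose J]
  rfl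

theorem exists_linearIndependent_row_submatrix (M : Matrix m n F) {k : ℕ} (hk : k ≤ M.rank) :
    ∃ r : Fin k → m, LinearIndependent F (M.submatrix r id).row := by
  rw [rank_eq_finrank_span_row] at hk
  obtain ⟨f, hf, -, hli⟩ := Submodule.exists_fun_fin_finrank_span_eq F (Set.range M.row)
  choose r hr using hf
  refine ⟨fun i => r (Fin.castLE hk i), ?_⟩
  have : (M.submatrix (fun i => r (Fin.castLE hk i)) id).row = f ∘ Fin.castLE hk :=
    funext fun i => hr _
  rw [this]
  exact hli.comp _ (Fin.castLE_injective hk)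

theorem exists_det_submatrix_ne_zero (M : Matrix m n F) {k : ℕ} (hk : k ≤ M.rank) :
    ∃ (r : Fin k → m) (c : Fin k → n), (M.submatrix r c).det ≠ 0 := by
  obtain ⟨r, hr⟩ := M.exists_linearIndependent_row_submatrix hk
  have h1 : (M.submatrix r id)ᵀ.rank = k := by
    rw [rank_transpose, hr.rank_matrix, Fintype.card_fin]
  obtain ⟨c, hc⟩ := (M.submatrix r id)ᵀ.exists_linearIndependent_row_submatrix h1.ge
  refine ⟨r, c, ?_⟩
  rw [linearIndependent_rows_iff_isUnit, isUnit_iff_isUnit_det, isUnit_iff_ne_zero] at hc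
  rw [← det_transpose]
  exact hc

theorem le_rank_of_det_submatrix_ne_zero {p : Type*} (M : Matrix p n F) {k : ℕ} (r : Fin k → p)
    (c : Fin k → n) (h : (M.submatrix r c).det ≠ 0) : k ≤ M.rank := by
  have := rank_of_det_ne_zero h
  rw [Fintype.card_fin] at this
  rw [← this]
  exact rank_submatrix_le M r c

theorem det_submatrix_map {R S p q : Type*} [CommRing R] [CommRing S] (M : Matrix p q S)
    (e : S →+* R) {k : ℕ} (r : Fin k → p) (c : Fin k → q) :
    ((M.map e).submatrix r c).det = e (M.submatrix r c).det :=
  (e.map_det (M.submatrix r c)).symm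

/-- A minor that is nonzero after specialization by `e` was nonzero in `S`, so it stays nonzero in
`L`. -/
theorem rank_map_le_rank_map {S : Type*} [CommRing S] {L : Type*} [Field L] (M : Matrix m n S)
    (i : S →+* L) (hi : Function.Injective i) (e : S →+* F) :
    (M.map e).rank ≤ (M.map i).rank := by
  obtain ⟨r, c, h⟩ := (M.map e).exists_det_submatrix_ne_zero le_rfl
  refine le_rank_of_det_submatrix_ne_zero _ r c ?_
  rw [det_submatrix_map] at h ⊢
  exact fun h0 => h (by rw [(map_eq_zero_iff i hi).1 h0, map_zero])

/-- The element `s` is a minor of size `k` that does not vanish in `L`. -/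
theorem exists_ne_zero_forall_le_rank_map {S : Type*} [CommRing S] {L : Type*} [Field L]
    (M : Matrix m n S) (i : S →+* L) {k : ℕ} (hk : k ≤ (M.map i).rank) :
    ∃ s : S, s ≠ 0 ∧ ∀ e : S →+* F, e s ≠ 0 → k ≤ (M.map e).rank := by
  obtain ⟨r, c, h⟩ := (M.map i).exists_det_submatrix_ne_zero hk
  refine ⟨(M.submatrix r c).det, ?_, fun e he => le_rank_of_det_submatrix_ne_zero _ r c ?_⟩
  · rw [det_submatrix_map] at h
    exact fun h0 => h (by rw [h0, map_zero])
  · rwa [det_submatrix_map]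

end Matrix

end LinearAlgebra

theorem Derivation.map_mvPolynomial_aeval {K L σ : Type*} [Field K] [Field L] [Algebra K L]
    [Fintype σ] (D : Derivation K L L) (y : σ → L) (p : MvPolynomial σ K) :
    D (aeval y p) = ∑ i, aeval y (pderiv i p) * D (y i) := by
  classical
  induction p using MvPolynomial.induction_on with
  | C a => simp
  | add p q hp hq => simp [hp, hq, add_mul, Finset.sum_add_distrib]
  | mul_X p i hp =>
    have hs : ∀ j, aeval y (pderiv j (p * X i)) * D (y j) =
        y i * (aeval y (pderiv j p) * D (y j)) + (if i = j then aeval y p * D (y j) else 0) :=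
      fun j => by
        by_cases h : i = j
        · subst h; simp; ring
        · simp [pderiv_X, h]; ring
    simp only [hs, Finset.sum_add_distrib, ← Finset.mul_sum, Finset.sum_ite_eq, Finset.mem_univ,
      if_true, map_mul, aeval_X, D.leibniz, hp, smul_eq_mul]
    ring

/-! ### The conormal map at the generic point. -/

noncomputable section

namespace ConormalVariety

variable {K σ τ : Type*} [Field K] [Fintype σ] [Fintype τ] (I : Ideal (MvPolynomial σ K))

/-- The coordinate ring of `V(I) × 𝔸^τ`. -/
abbrev TotalRing (τ : Type*) : Type _ := MvPolynomial τ (MvPolynomial σ K ⧸ I)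

/-- Pull-back of functions from the affine space to `V(I) × 𝔸^τ`. -/
def pullback (τ : Type*) : MvPolynomial σ K →ₐ[K] TotalRing I τ :=
  (IsScalarTower.toAlgHom K (MvPolynomial σ K ⧸ I) (TotalRing I τ)).comp (Ideal.Quotient.mkₐ K I)

omit [Fintype σ] [Fintype τ] in
theorem pullback_apply (p : MvPolynomial σ K) :
    pullback I τ p = C (Ideal.Quotient.mk I p) := rfl

omit [Fintype σ] [Fintype τ] in
theorem pullback_eq_zero_iff (p : MvPolynomial σ K) : pullback I τ p = 0 ↔ p ∈ I := by
  rw [pullback_apply, MvPolynomial.C_eq_zero, Ideal.Quotient.eq_zero_iff_mem]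

/-- The Jacobian matrix of the polynomials `f`, on `V(I) × 𝔸^τ`. -/
def jacobian (f : τ → MvPolynomial σ K) : Matrix τ σ (TotalRing I τ) :=
  Matrix.of fun a i => pullback I τ (pderiv i (f a))

/-- The Hessian of the universal linear combination of the polynomials `f`. -/
def hessian (f : τ → MvPolynomial σ K) : Matrix σ σ (TotalRing I τ) :=
  Matrix.of fun i j => ∑ a, X a * pullback I τ (pderiv j (pderiv i (f a)))

/-- The differential of the universal linear combination of the polynomials `f`. -/
def covector (f : τ → MvPolynomial σ K) (i : σ) : TotalRing I τ :=
  ∑ a, X a * pullback I τ (pderiv i (f a))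

/-- The bordered Hessian of the universal linear combination of the polynomials `f`. -/
def borderedHessian (f : τ → MvPolynomial σ K) : Matrix (σ ⊕ τ) (σ ⊕ τ) (TotalRing I τ) :=
  Matrix.fromBlocks (hessian I f) (jacobian I f).transpose (jacobian I f) 0

section Generic

variable {I} [I.IsPrime] [CharZero K] {f : τ → MvPolynomial σ K}

/-- The function field of `V(I) × 𝔸^τ`. -/
abbrev TotalField (I : Ideal (MvPolynomial σ K)) [I.IsPrime] (τ : Type*) : Type _ :=
  FractionRing (TotalRing I τ)

instance : Algebra.EssFiniteType K (TotalField I τ) :=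
  have : Algebra.FiniteType K (TotalRing I τ) :=
    .trans (S := MvPolynomial σ K ⧸ I) inferInstance inferInstance
  have : Algebra.EssFiniteType (TotalRing I τ) (TotalField I τ) :=
    .of_isLocalization _ (nonZeroDivisors (TotalRing I τ))
  .comp K (TotalRing I τ) (TotalField I τ)

instance : Algebra.FormallySmooth (TotalRing I τ) (TotalField I τ) :=
  .of_isLocalization (nonZeroDivisors _)

omit [Fintype σ] [Fintype τ] [CharZero K] in
theorem algebraMap_totalField_injective (I : Ideal (MvPolynomial σ K)) [I.IsPrime] (τ : Type*) :
    Function.Injective (algebraMap (TotalRing I τ) (TotalField I τ)) :=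
  IsFractionRing.injective (TotalRing I τ) (TotalField I τ)

omit [Fintype σ] [Fintype τ] [CharZero K] in
theorem algebraMap_totalField_eq_zero_iff {s : TotalRing I τ} :
    algebraMap (TotalRing I τ) (TotalField I τ) s = 0 ↔ s = 0 :=
  map_eq_zero_iff _ (algebraMap_totalField_injective I τ)

/-- The coordinate functions as elements of the function field. -/
def coordinate (I : Ideal (MvPolynomial σ K)) [I.IsPrime] (τ : Type*) (i : σ) :
    TotalField I τ :=
  algebraMap (TotalRing I τ) (TotalField I τ) (pullback I τ (X i))

omit [Fintype σ] [Fintype τ] [CharZero K] in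
theorem aeval_coordinate (p : MvPolynomial σ K) :
    aeval (coordinate I τ) p = algebraMap (TotalRing I τ) (TotalField I τ) (pullback I τ p) := by
  have : aeval (coordinate I τ) =
      (IsScalarTower.toAlgHom K (TotalRing I τ) (TotalField I τ)).comp (pullback I τ) := by
    ext i
    simp [coordinate]
  rw [this]
  rfl

/-- The Jacobian matrix over the function field. -/
abbrev genericJacobian (I : Ideal (MvPolynomial σ K)) [I.IsPrime] (f : τ → MvPolynomial σ K) :
    Matrix τ σ (TotalField I τ) :=
  (jacobian I f).map (algebraMap (TotalRing I τ) (TotalField I τ))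

/-- The Hessian matrix over the function field. -/
abbrev genericHessian (I : Ideal (MvPolynomial σ K)) [I.IsPrime] (f : τ → MvPolynomial σ K) :
    Matrix σ σ (TotalField I τ) :=
  (hessian I f).map (algebraMap (TotalRing I τ) (TotalField I τ))

omit [Fintype τ] [CharZero K] in
theorem derivation_coordinate_mem (hf : Ideal.span (Set.range f) = I)
    (D : Derivation K (TotalField I τ) (TotalField I τ)) :
    (genericJacobian I f).mulVec (fun i => D (coordinate I τ i)) = 0 := by
  funext a
  have h := D.map_mvPolynomial_aeval (coordinate I τ) (f a)
  have h0 : pullback I τ (f a) = 0 :=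
    (pullback_eq_zero_iff I _).2 (hf ▸ Ideal.subset_span ⟨a, rfl⟩)
  rw [aeval_coordinate, h0, map_zero, map_zero] at h
  rw [Pi.zero_apply, h]
  simp only [aeval_coordinate]
  rfl

omit [Fintype τ] [CharZero K] in
-- The tangency condition on the generators suffices for all of `I`: by the product rule, since
-- elements of `I` vanish on `V(I)`, `d(p x) = p dx` there for `x ∈ I`.
theorem exists_derivation (hf : Ideal.span (Set.range f) = I) (v : σ → TotalField I τ)
    (μ : τ → TotalField I τ) (hv : (genericJacobian I f).mulVec v = 0) :
    ∃ D : Derivation K (TotalField I τ) (TotalField I τ),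
      (∀ i, D (coordinate I τ i) = v i) ∧
        ∀ a, D (algebraMap (TotalRing I τ) (TotalField I τ) (X a)) = μ a := by
  refine Derivation.exists_of_mvPolynomial_quotient I v μ fun g hg => ?_
  change ∑ i, v i * algebraMap (TotalRing I τ) (TotalField I τ) (pullback I τ (pderiv i g)) = 0
  have hg' := hg
  rw [← hf] at hg'
  induction hg' using Submodule.span_induction with
  | mem x hx =>
    obtain ⟨a, rfl⟩ := hx
    have := congrFun hv a
    rw [Pi.zero_apply] at this
    rw [← this]
    exact Finset.sum_congr rfl fun i _ => mul_comm _ _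
  | zero => simp
  | add x y hx hy hx' hy' =>
    simp only [map_add, mul_add, Finset.sum_add_distrib]
    rw [hx' (hf ▸ hx), hy' (hf ▸ hy), add_zero]
  | smul p x hx hx' =>
    have h0 : pullback I τ x = 0 := (pullback_eq_zero_iff I _).2 (hf ▸ hx)
    have h1 := hx' (hf ▸ hx)
    simp only [smul_eq_mul, Derivation.leibniz, map_add, map_mul, h0, zero_mul, add_zero]
    rw [← mul_zero (algebraMap (TotalRing I τ) (TotalField I τ) (pullback I τ p)), ← h1,
      Finset.mul_sum]
    exact Finset.sum_congr rfl fun i _ => by ring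

theorem ringKrullDim_quotient_eq_finrank_ker (hf : Ideal.span (Set.range f) = I) :
    ringKrullDim (MvPolynomial σ K ⧸ I) =
      (Module.finrank (TotalField I τ)
        (LinearMap.ker (genericJacobian I f).mulVecLin) : WithBot ℕ∞) := by
  have h := ringKrullDim_quotient_ker_aeval (K := K) (coordinate I τ)
  have hker : RingHom.ker (aeval (coordinate I τ) : MvPolynomial σ K →ₐ[K] TotalField I τ) = I := by
    ext p
    rw [RingHom.mem_ker, aeval_coordinate, algebraMap_totalField_eq_zero_iff,
      pullback_eq_zero_iff]
  have hrange : LinearMap.range (Derivation.evalFamily K (coordinate I τ)) =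
      LinearMap.ker (genericJacobian I f).mulVecLin := by
    ext v
    constructor
    · rintro ⟨D, rfl⟩
      exact derivation_coordinate_mem hf D
    · intro hv
      obtain ⟨D, hD, -⟩ := exists_derivation hf v 0 hv
      exact ⟨D, funext hD⟩
  rw [hker, hrange] at h
  exact h

omit [CharZero K] in
theorem derivation_covector (D : Derivation K (TotalField I τ) (TotalField I τ)) (i : σ) :
    D (algebraMap (TotalRing I τ) (TotalField I τ) (covector I f i)) =
      (genericHessian I f).mulVec (fun j => D (coordinate I τ j)) i +
      (genericJacobian I f).transpose.mulVec
        (fun a => D (algebraMap (TotalRing I τ) (TotalField I τ) (X a))) i := by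
  have h : ∀ a, D (algebraMap (TotalRing I τ) (TotalField I τ)
      (X a * pullback I τ (pderiv i (f a)))) =
      (∑ j, algebraMap (TotalRing I τ) (TotalField I τ)
        (X a * pullback I τ (pderiv j (pderiv i (f a)))) * D (coordinate I τ j)) +
      algebraMap (TotalRing I τ) (TotalField I τ) (pullback I τ (pderiv i (f a))) *
        D (algebraMap (TotalRing I τ) (TotalField I τ) (X a)) := fun a => by
    rw [map_mul, D.leibniz, ← aeval_coordinate, D.map_mvPolynomial_aeval]
    simp only [aeval_coordinate, smul_eq_mul, Finset.mul_sum, map_mul, mul_assoc]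
  rw [covector, map_sum, map_sum]
  simp only [h, Finset.sum_add_distrib]
  congr 1
  rw [Finset.sum_comm]
  refine Finset.sum_congr rfl fun j _ => ?_
  change _ = algebraMap (TotalRing I τ) (TotalField I τ)
    (∑ a, X a * pullback I τ (pderiv j (pderiv i (f a)))) * D (coordinate I τ j)
  rw [map_sum, Finset.sum_mul]

theorem ringKrullDim_quotient_ker_covector (hf : Ideal.span (Set.range f) = I) :
    ringKrullDim (MvPolynomial σ K ⧸
        RingHom.ker (aeval (covector I f) : MvPolynomial σ K →ₐ[K] TotalRing I τ)) =
      (Module.finrank (TotalField I τ)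
        ((LinearMap.ker ((genericJacobian I f).mulVecLin.comp
          (LinearMap.fst (TotalField I τ) (σ → TotalField I τ) (τ → TotalField I τ)))).map
            ((genericHessian I f).mulVecLin.coprod (genericJacobian I f).transpose.mulVecLin)) :
        WithBot ℕ∞) := by
  let ξ : σ → TotalField I τ := fun i =>
    algebraMap (TotalRing I τ) (TotalField I τ) (covector I f i)
  have h := ringKrullDim_quotient_ker_aeval (K := K) ξ
  have hξ : ∀ p : MvPolynomial σ K, aeval ξ p =
      algebraMap (TotalRing I τ) (TotalField I τ) (aeval (covector I f) p) := fun p => by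
    rw [← aeval_algebraMap_apply]
    rfl
  have hker : RingHom.ker (aeval ξ : MvPolynomial σ K →ₐ[K] TotalField I τ) =
      RingHom.ker (aeval (covector I f) : MvPolynomial σ K →ₐ[K] TotalRing I τ) := by
    ext p
    rw [RingHom.mem_ker, hξ, algebraMap_totalField_eq_zero_iff, RingHom.mem_ker]
  have hrange : LinearMap.range (Derivation.evalFamily K ξ) =
      (LinearMap.ker ((genericJacobian I f).mulVecLin.comp
          (LinearMap.fst (TotalField I τ) (σ → TotalField I τ) (τ → TotalField I τ)))).map
            ((genericHessian I f).mulVecLin.coprod (genericJacobian I f).transpose.mulVecLin) := by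
    ext w
    constructor
    · rintro ⟨D, rfl⟩
      exact ⟨(_, _), derivation_coordinate_mem hf D, funext fun i => (derivation_covector D i).symm⟩
    · rintro ⟨⟨v, μ⟩, hv, rfl⟩
      obtain ⟨D, hD, hD'⟩ := exists_derivation hf v μ hv
      refine ⟨D, funext fun i => (derivation_covector D i).trans ?_⟩
      simp only [hD, hD']
      rfl
  rw [hker, hrange] at h
  exact h

theorem exists_ringKrullDim_eq_rank (hf : Ideal.span (Set.range f) = I) :
    ∃ d e : ℕ, ringKrullDim (MvPolynomial σ K ⧸ I) = d ∧
      ringKrullDim (MvPolynomial σ K ⧸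
        RingHom.ker (aeval (covector I f) : MvPolynomial σ K →ₐ[K] TotalRing I τ)) = e ∧
      (genericJacobian I f).rank + d = Fintype.card σ ∧
      ((borderedHessian I f).map (algebraMap (TotalRing I τ) (TotalField I τ))).rank =
        (genericJacobian I f).rank + e := by
  refine ⟨_, _, ringKrullDim_quotient_eq_finrank_ker hf, ringKrullDim_quotient_ker_covector hf,
    ?_, ?_⟩
  · rw [Matrix.rank, LinearMap.finrank_range_add_finrank_ker, Module.finrank_fintype_fun_eq_card]
  · rw [← Matrix.rank_fromBlocks_transpose, borderedHessian, Matrix.fromBlocks_map]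
    congr 1
    simp [Matrix.transpose_map]

end Generic

end ConormalVariety

end

/-! ### Bilinear forms and nonsingularity on a complement of the kernel. -/

section BilinearForms

variable {F V Q : Type*} [Field F] [AddCommGroup V] [Module F V] [FiniteDimensional F V]
  [AddCommGroup Q] [Module F Q]

theorem LinearMap.le_finrank_range_of_det_ne_zero (Φ : V →ₗ[F] V →ₗ[F] F) {r : ℕ} (A : Fin r → V)
    (hA : (Matrix.of fun p q => Φ (A p) (A q)).det ≠ 0) :
    r ≤ Module.finrank F (range Φ) := by
  have hli : LinearIndependent F fun p => Φ (A p) := by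
    rw [Fintype.linearIndependent_iff]
    intro c hc
    by_contra! hne
    refine hA (Matrix.exists_vecMul_eq_zero_iff.1 ⟨c, fun h0 => ?_, funext fun q => ?_⟩)
    · obtain ⟨i, hi⟩ := hne
      exact hi (congrFun h0 i)
    · have := LinearMap.congr_fun hc (A q)
      simpa [Matrix.vecMul, dotProduct] using this
  have hle : Submodule.span F (Set.range fun p => Φ (A p)) ≤ range Φ := by
    rw [Submodule.span_le]
    rintro _ ⟨p, rfl⟩
    exact ⟨A p, rfl⟩
  have := Submodule.finrank_mono hle
  rwa [finrank_span_eq_card hli, Fintype.card_fin] at this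

theorem LinearMap.finrank_range_compr₂_le (B : V →ₗ[F] V →ₗ[F] Q) (ξ : Q →ₗ[F] F) :
    Module.finrank F (range (B.compr₂ ξ)) ≤ Module.finrank F (range B) := by
  have h : range (B.compr₂ ξ) = (range B).map (LinearMap.llcomp F V Q F ξ) := by
    rw [← LinearMap.range_comp]
    rfl
  rw [h]
  exact Submodule.finrank_map_le _ _

/-- The rank bounds force the form and `B` to have the same kernel, and a symmetric form is
nondegenerate on any complement of its kernel. -/
theorem LinearMap.exists_isCompl_ker_det_ne_zero (B : V →ₗ[F] V →ₗ[F] Q) (ξ : Q →ₗ[F] F)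
    (hsymm : ∀ v u, ξ (B v u) = ξ (B u v)) {r : ℕ} (hB : Module.finrank F (range B) ≤ r)
    (hr : r ≤ Module.finrank F (range (B.compr₂ ξ))) :
    ∃ A : Fin r → V, IsCompl (Submodule.span F (Set.range A)) (ker B) ∧
      (Matrix.of fun p q => B.compr₂ ξ (A p) (A q)).det ≠ 0 := by
  have h1 := B.finrank_range_compr₂_le ξ
  have hle : ker B ≤ ker (B.compr₂ ξ) := fun v hv => by
    refine LinearMap.ext fun u => ?_
    rw [LinearMap.compr₂_apply, LinearMap.mem_ker.1 hv]
    simp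
  have hker : ker B = ker (B.compr₂ ξ) := by
    refine Submodule.eq_of_le_of_finrank_eq hle ?_
    have h3 := B.finrank_range_add_finrank_ker
    have h4 := (B.compr₂ ξ).finrank_range_add_finrank_ker
    omega
  obtain ⟨C, hC⟩ := exists_isCompl (ker B)
  have hCr : Module.finrank F C = r := by
    have h3 := B.finrank_range_add_finrank_ker
    have h4 := Submodule.finrank_add_eq_of_isCompl hC
    omega
  let b := Module.finBasisOfFinrankEq F C hCr
  have hspan : Submodule.span F (Set.range fun p => (b p : V)) = C := by
    have : (Set.range fun p => (b p : V)) = C.subtype '' Set.range b := by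
      rw [← Set.range_comp]; rfl
    rw [this, Submodule.span_image, b.span_eq, Submodule.map_top, Submodule.range_subtype]
  refine ⟨fun p => (b p : V), by rw [hspan]; exact hC.symm, fun hdet => ?_⟩
  obtain ⟨c, hc0, hc⟩ := Matrix.exists_mulVec_eq_zero_iff.2 hdet
  obtain ⟨u, hu⟩ : ∃ u : C, u = ∑ q, c q • b q := ⟨_, rfl⟩
  have hu1 : ∀ p, ξ (B (b p) u) = 0 := fun p => by
    have := congrFun hc p
    simpa [Matrix.mulVec, dotProduct, hu, mul_comm] using this
  -- By symmetry `u` is orthogonal to `ker B` and to `C`, hence to everything; so `u ∈ ker B ⊓ C =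
  -- 0`.
  have hle2 : ker B ⊔ C ≤ ker (B.compr₂ ξ (u : V)) := by
    refine sup_le (fun k hk => ?_) (hspan.symm.le.trans (Submodule.span_le.2 ?_))
    · rw [LinearMap.mem_ker, LinearMap.compr₂_apply, hsymm, LinearMap.mem_ker.1 hk]
      simp
    · rintro _ ⟨p, rfl⟩
      exact (hsymm _ _).trans (hu1 p)
  rw [hC.sup_eq_top, top_le_iff, LinearMap.ker_eq_top] at hle2
  have hmem : (u : V) ∈ ker B ⊓ C := ⟨by rw [hker]; exact hle2, u.2⟩
  rw [hC.inf_eq_bot] at hmem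
  have hu4 : ∑ q, c q • b q = 0 := hu ▸ Subtype.ext hmem
  exact hc0 (funext fun q => Fintype.linearIndependent_iff.1 b.linearIndependent c hu4 q)

end BilinearForms

theorem MvPolynomial.pderiv_comm {R σ : Type*} [CommRing R] (i j : σ) (p : MvPolynomial σ R) :
    pderiv i (pderiv j p) = pderiv j (pderiv i p) := by
  classical
  let d : σ → Derivation R (MvPolynomial σ R) (MvPolynomial σ R) := pderiv
  let D : Derivation R (MvPolynomial σ R) (MvPolynomial σ R) := ⁅d i, d j⁆
  have h : D = 0 := by
    refine derivation_ext fun k => ?_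
    rw [Derivation.commutator_apply]
    change pderiv i (pderiv j (X k)) - pderiv j (pderiv i (X k)) = 0
    rw [pderiv_X, pderiv_X]
    simp only [Pi.single_apply]
    split_ifs <;> simp
  have h' : D p = 0 := by rw [h, Derivation.zero_apply]
  rwa [Derivation.commutator_apply, sub_eq_zero] at h'

/-! ### The second fundamental form as a restricted Hessian. -/

noncomputable section

namespace DualVar

variable {K : Type*} [Field K] {N : ℕ}

/-- The gradient of a polynomial at a point. -/
def gradAt (F : MvPolynomial (Fin (N + 1)) K) (x : Vec K N) : Vec K N :=
  fun i => eval x (pderiv i F)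

/-- The Hessian matrix of a polynomial at a point. -/
def hessAt (F : MvPolynomial (Fin (N + 1)) K) (x : Vec K N) :
    Matrix (Fin (N + 1)) (Fin (N + 1)) K :=
  Matrix.of fun i j => eval x (pderiv j (pderiv i F))

/-- The bilinear form of a matrix, restricted to a subspace. -/
def restrictForm (T : Submodule K (Vec K N)) (H : Matrix (Fin (N + 1)) (Fin (N + 1)) K) :
    T →ₗ[K] T →ₗ[K] K :=
  ((dotProductBilin K K).comp H.mulVecLin).domRestrict₁₂ T T

@[simp]
theorem restrictForm_apply (T : Submodule K (Vec K N)) (H : Matrix (Fin (N + 1)) (Fin (N + 1)) K)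
    (v u : T) : restrictForm T H v u = (H.mulVec (v : Vec K N)) ⬝ᵥ (u : Vec K N) := rfl

theorem hessAt_transpose (F : MvPolynomial (Fin (N + 1)) K) (x : Vec K N) :
    (hessAt F x).transpose = hessAt F x := by
  ext i j
  simp only [hessAt, Matrix.transpose_apply, Matrix.of_apply]
  rw [MvPolynomial.pderiv_comm]

theorem restrictForm_hessAt_comm (T : Submodule K (Vec K N)) (F : MvPolynomial (Fin (N + 1)) K)
    (x : Vec K N) (v u : T) :
    restrictForm T (hessAt F x) v u = restrictForm T (hessAt F x) u v := by
  rw [restrictForm_apply, restrictForm_apply, dotProduct_comm, Matrix.dotProduct_mulVec,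
    ← Matrix.mulVec_transpose, hessAt_transpose]

variable {X : Set (PSpace K N)}

theorem mem_idealOf_iff {F : MvPolynomial (Fin (N + 1)) K} :
    F ∈ idealOf X ↔ ∀ y ∈ coneOf X, eval y F = 0 := by
  simp [idealOf, MvPolynomial.mem_vanishingIdeal_iff]

theorem mem_tangentSpace_iff {x w : Vec K N} :
    w ∈ tangentSpace X x ↔ ∀ F ∈ idealOf X, gradAt F x ⬝ᵥ w = 0 := by
  refine forall₂_congr fun F _ => ?_
  rw [dotProduct_comm]
  rfl

/-- The function `∑ W_i ∂_i F` vanishes on `X`, so its derivative along the tangent vector `v` is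
zero; expand by the product rule. -/
theorem gradAt_dotProduct_fieldDeriv {W : Fin (N + 1) → MvPolynomial (Fin (N + 1)) K}
    (hW : ∀ y ∈ coneOf X, fieldValue W y ∈ tangentSpace X y)
    {F : MvPolynomial (Fin (N + 1)) K} (hF : F ∈ idealOf X) {x v : Vec K N}
    (hv : v ∈ tangentSpace X x) :
    gradAt F x ⬝ᵥ fieldDeriv W x v = -((hessAt F x).mulVec v ⬝ᵥ fieldValue W x) := by
  have hp : ∑ i, W i * pderiv i F ∈ idealOf X := by
    rw [mem_idealOf_iff]
    intro y hy
    simp only [map_sum, map_mul]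
    exact hW y hy F hF
  have h := hv _ hp
  simp only [map_sum, Derivation.leibniz, smul_eq_mul, map_add, map_mul] at h
  rw [eq_neg_iff_add_eq_zero, ← h]
  simp only [dotProduct, gradAt, fieldDeriv, hessAt, fieldValue, Matrix.mulVec, Matrix.of_apply,
    Finset.mul_sum, Finset.sum_mul, mul_add, Finset.sum_add_distrib]
  rw [add_comm]
  congr 1
  · rw [Finset.sum_comm]
    exact Finset.sum_congr rfl fun i _ => Finset.sum_congr rfl fun j _ => by ring
  · rw [Finset.sum_comm]
    exact Finset.sum_congr rfl fun i _ => Finset.sum_congr rfl fun j _ => by ring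

/-- The tangent space at `x` is spanned by polynomial vector fields that are tangent to `X`. -/
def HasTangentFields (X : Set (PSpace K N)) (x : Vec K N) : Prop :=
  ∀ w ∈ tangentSpace X x, ∃ W : Fin (N + 1) → MvPolynomial (Fin (N + 1)) K,
    fieldValue W x = w ∧ ∀ y ∈ coneOf X, fieldValue W y ∈ tangentSpace X y

/-- The derivative of a vector field at a point as a linear map. -/
def fieldDerivLinear (W : Fin (N + 1) → MvPolynomial (Fin (N + 1)) K) (x : Vec K N) :
    Vec K N →ₗ[K] Vec K N where
  toFun := fieldDeriv W x
  map_add' a b := by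
    funext i
    simp [fieldDeriv, add_mul, Finset.sum_add_distrib]
  map_smul' c a := by
    funext i
    simp [fieldDeriv, mul_assoc, Finset.mul_sum]

/-- Fields through a basis of `T_x` define `B`. Modulo `T_x` the derivative of a tangent field
depends only on its value at `x`, because its pairings with the gradients of `I(X)` do. -/
theorem exists_isGaussDifferential {x : Vec K N} (hx : HasTangentFields X x) :
    ∃ B, IsGaussDifferential X x B := by
  let b := Module.finBasis K (tangentSpace X x)
  choose W hWx hW using fun i => hx (b i) (b i).2
  let B : tangentSpace X x →ₗ[K] tangentSpace X x →ₗ[K] (Vec K N ⧸ tangentSpace X x) :=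
    (b.constr K).toLinearMap.comp (LinearMap.pi fun i =>
      (tangentSpace X x).mkQ.comp ((fieldDerivLinear (W i) x).comp (tangentSpace X x).subtype))
  have hB : ∀ v u, B v u = (tangentSpace X x).mkQ
      (∑ i, b.repr u i • fieldDeriv (W i) x (v : Vec K N)) := fun v u => by
    rw [map_sum]
    simp only [map_smul]
    exact b.constr_apply_fintype K _ u
  refine ⟨B, fun V hVx hV v => ?_⟩
  rw [hB]
  refine (Submodule.Quotient.eq _).2 (mem_tangentSpace_iff.2 fun F hF => ?_)
  have hu : (∑ i, b.repr ⟨fieldValue V x, hVx⟩ i • (b i : Vec K N)) = fieldValue V x := by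
    have := congrArg (tangentSpace X x).subtype (b.sum_repr ⟨fieldValue V x, hVx⟩)
    rw [map_sum] at this
    exact this
  rw [dotProduct_sub, gradAt_dotProduct_fieldDeriv hV hF v.2, dotProduct_sum]
  simp only [dotProduct_smul, gradAt_dotProduct_fieldDeriv (hW _) hF v.2, hWx]
  have := congrArg (fun z => (hessAt F x).mulVec (v : Vec K N) ⬝ᵥ z) hu
  simp only [dotProduct_sum, dotProduct_smul] at this
  rw [← this]
  simp

theorem isGaussDifferential_gaussDifferential {x : Vec K N} (hx : HasTangentFields X x) :
    IsGaussDifferential X x (gaussDifferential X x) := by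
  have h := exists_isGaussDifferential hx
  rw [gaussDifferential, dif_pos h]
  exact h.choose_spec

theorem secondFundamentalForm_eq {x : Vec K N} (hx : HasTangentFields X x)
    {ξ : Module.Dual K (Vec K N ⧸ tangentSpace X x)} {F : MvPolynomial (Fin (N + 1)) K}
    (hF : F ∈ idealOf X) (hξ : ∀ z, ξ (Submodule.Quotient.mk z) = gradAt F x ⬝ᵥ z) :
    secondFundamentalForm X x ξ = -restrictForm (tangentSpace X x) (hessAt F x) := by
  refine LinearMap.ext fun v => LinearMap.ext fun u => ?_
  obtain ⟨W, hWx, hW⟩ := hx u u.2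
  have hmem : fieldValue W x ∈ tangentSpace X x := hWx ▸ u.2
  have hu : u = ⟨fieldValue W x, hmem⟩ := Subtype.ext hWx.symm
  change ξ (gaussDifferential X x v u) = -(restrictForm (tangentSpace X x) (hessAt F x) v u)
  rw [hu, isGaussDifferential_gaussDifferential hx W hmem hW v, hξ,
    gradAt_dotProduct_fieldDeriv hW hF v.2]
  rfl

theorem finrank_range_gaussDifferential_le {x : Vec K N} (hx : x ∈ smoothLocus X) :
    Module.finrank K (LinearMap.range (gaussDifferential X x)) ≤ gaussRank X := by
  -- The bound matters: `sSup` of an unbounded set of naturals would be `0`.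
  refine le_csSup ⟨N + 1, ?_⟩ ⟨x, hx, rfl⟩
  rintro _ ⟨y, -, rfl⟩
  refine (LinearMap.finrank_range_le _).trans ((Submodule.finrank_le _).trans ?_)
  simp

theorem exists_dual_eq_gradAt {x : Vec K N} {F : MvPolynomial (Fin (N + 1)) K}
    (hF : F ∈ idealOf X) : ∃ ξ : Module.Dual K (Vec K N ⧸ tangentSpace X x),
      ∀ z, ξ (Submodule.Quotient.mk z) = gradAt F x ⬝ᵥ z :=
  ⟨(tangentSpace X x).liftQ (dotProductBilin K K (gradAt F x))
    fun _ hz => mem_tangentSpace_iff.1 hz F hF, fun _ => rfl⟩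

theorem finrank_range_restrictForm_le {x : Vec K N} (hx : HasTangentFields X x)
    (hxs : x ∈ smoothLocus X) {F : MvPolynomial (Fin (N + 1)) K} (hF : F ∈ idealOf X) :
    Module.finrank K (LinearMap.range (restrictForm (tangentSpace X x) (hessAt F x))) ≤
      gaussRank X := by
  obtain ⟨ξ, hξ⟩ := exists_dual_eq_gradAt (x := x) hF
  rw [← LinearMap.range_neg, ← secondFundamentalForm_eq hx hF hξ]
  exact (LinearMap.finrank_range_compr₂_le _ ξ).trans (finrank_range_gaussDifferential_le hxs)

theorem exists_isNonsingularAt {x : Vec K N} (hx : HasTangentFields X x)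
    (hxs : x ∈ smoothLocus X) {F : MvPolynomial (Fin (N + 1)) K} (hF : F ∈ idealOf X)
    (hr : gaussRank X ≤ Module.finrank K
      (LinearMap.range (restrictForm (tangentSpace X x) (hessAt F x)))) :
    ∃ ξ, IsNonsingularAt X x ξ := by
  obtain ⟨ξ, hξ⟩ := exists_dual_eq_gradAt (x := x) hF
  have hΦ := secondFundamentalForm_eq hx hF hξ
  refine ⟨ξ, ?_⟩
  rw [← LinearMap.range_neg, ← hΦ] at hr
  refine LinearMap.exists_isCompl_ker_det_ne_zero (gaussDifferential X x) ξ (fun v u => ?_)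
    (finrank_range_gaussDifferential_le hxs) hr
  change secondFundamentalForm X x ξ v u = secondFundamentalForm X x ξ u v
  rw [hΦ]
  exact congrArg Neg.neg (restrictForm_hessAt_comm _ F x v u)

theorem gaussRank_le_of_isNonsingularAt {x : Vec K N}
    {ξ : Module.Dual K (Vec K N ⧸ tangentSpace X x)} (h : IsNonsingularAt X x ξ) :
    gaussRank X ≤ Module.finrank K (LinearMap.range (secondFundamentalForm X x ξ)) := by
  obtain ⟨A, -, hA⟩ := h
  exact LinearMap.le_finrank_range_of_det_ne_zero _ A hA

end DualVar

end

/-! ### Specialization at points of `X × 𝔸^τ`. -/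

noncomputable section

namespace DualVar

open ConormalVariety

variable {K : Type*} [Field K] {N : ℕ} {X : Set (PSpace K N)} {τ : Type*}

/-- Evaluation of functions on `X × 𝔸^τ` at a point. -/
def evalPoint {x : Vec K N} (hx : x ∈ coneOf X) (μ : τ → K) :
    TotalRing (idealOf X) τ →+* K :=
  eval₂Hom (Ideal.Quotient.lift (idealOf X) (eval x) fun _ hF => mem_idealOf_iff.1 hF x hx) μ

theorem evalPoint_pullback {x : Vec K N} (hx : x ∈ coneOf X) (μ : τ → K)
    (F : MvPolynomial (Fin (N + 1)) K) :
    evalPoint hx μ (pullback (idealOf X) τ F) = eval x F := by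
  rw [evalPoint, pullback_apply, eval₂Hom_C, Ideal.Quotient.lift_mk]

theorem evalPoint_X {x : Vec K N} (hx : x ∈ coneOf X) (μ : τ → K) (a : τ) :
    evalPoint hx μ (MvPolynomial.X a) = μ a :=
  eval₂Hom_X' _ _ _

/-- Take for `g` a nonzero coefficient of `s`, viewed as a polynomial in `μ`. Where `g` does not
vanish, this polynomial is nonzero over an infinite field and so has a nonzero value. -/
theorem exists_evalPoint_ne_zero [Infinite K] {s : TotalRing (idealOf X) τ} (hs : s ≠ 0) :
    ∃ g ∉ idealOf X, ∀ x (hx : x ∈ coneOf X), eval x g ≠ 0 → ∃ μ, evalPoint hx μ s ≠ 0 := by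
  obtain ⟨d, hd⟩ := MvPolynomial.ne_zero_iff.1 hs
  obtain ⟨g, hg⟩ := Ideal.Quotient.mk_surjective (coeff d s)
  refine ⟨g, fun h => hd (by rw [← hg, Ideal.Quotient.eq_zero_iff_mem.2 h]), fun x hx hgx => ?_⟩
  by_contra! hall
  let e : (MvPolynomial (Fin (N + 1)) K ⧸ idealOf X) →+* K :=
    Ideal.Quotient.lift (idealOf X) (eval x) fun F hF => mem_idealOf_iff.1 hF x hx
  have h0 : MvPolynomial.map e s = 0 := MvPolynomial.funext fun μ => by
    rw [eval_map, map_zero]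
    exact hall μ
  have h1 := congrArg (coeff d) h0
  rw [coeff_map, ← hg, coeff_zero] at h1
  exact hgx h1

theorem exists_mem_coneOf_eval_ne_zero {g : MvPolynomial (Fin (N + 1)) K} (hg : g ∉ idealOf X) :
    ∃ x ∈ coneOf X, eval x g ≠ 0 := by
  rw [mem_idealOf_iff] at hg
  push Not at hg
  exact hg

/-- The Jacobian matrix of polynomials `f` at a point. -/
def jacobianAt (f : τ → MvPolynomial (Fin (N + 1)) K) (x : Vec K N) :
    Matrix τ (Fin (N + 1)) K :=
  Matrix.of fun a => gradAt (f a) x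

theorem jacobian_map_evalPoint [Fintype τ] (f : τ → MvPolynomial (Fin (N + 1)) K) {x : Vec K N}
    (hx : x ∈ coneOf X) (μ : τ → K) :
    (jacobian (idealOf X) f).map (evalPoint hx μ) = jacobianAt f x := by
  ext a i
  exact evalPoint_pullback hx μ _

/-- A linear combination of polynomials with constant coefficients. -/
def linComb [Fintype τ] (f : τ → MvPolynomial (Fin (N + 1)) K) (μ : τ → K) :
    MvPolynomial (Fin (N + 1)) K :=
  ∑ a, C (μ a) * f a

variable [Fintype τ] {f : τ → MvPolynomial (Fin (N + 1)) K}

theorem linComb_mem (hf : Ideal.span (Set.range f) = idealOf X) (μ : τ → K) :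
    linComb f μ ∈ idealOf X :=
  Ideal.sum_mem _ fun a _ => Ideal.mul_mem_left _ _ (hf ▸ Ideal.subset_span ⟨a, rfl⟩)

theorem gradAt_linComb (μ : τ → K) (x : Vec K N) :
    gradAt (linComb f μ) x = (jacobianAt f x).transpose.mulVec μ := by
  funext i
  simp [gradAt, linComb, jacobianAt, Matrix.mulVec, dotProduct, mul_comm]

theorem evalPoint_covector {x : Vec K N} (hx : x ∈ coneOf X) (μ : τ → K) (i : Fin (N + 1)) :
    evalPoint hx μ (covector (idealOf X) f i) = gradAt (linComb f μ) x i := by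
  simp [covector, evalPoint_X, evalPoint_pullback, gradAt, linComb]

theorem hessian_map_evalPoint {x : Vec K N} (hx : x ∈ coneOf X) (μ : τ → K) :
    (hessian (idealOf X) f).map (evalPoint hx μ) = hessAt (linComb f μ) x := by
  ext i j
  simp [hessian, evalPoint_X, evalPoint_pullback, hessAt, linComb]

omit [Fintype τ] in
theorem mem_tangentSpace_iff_jacobianAt (hf : Ideal.span (Set.range f) = idealOf X) {x : Vec K N}
    (hx : x ∈ coneOf X) (w : Vec K N) :
    w ∈ tangentSpace X x ↔ (jacobianAt f x).mulVec w = 0 := by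
  rw [mem_tangentSpace_iff]
  constructor
  · exact fun h => funext fun a => h (f a) (hf ▸ Ideal.subset_span ⟨a, rfl⟩)
  · intro h F hF
    have hF' := hF
    rw [← hf] at hF'
    clear hF
    induction hF' using Submodule.span_induction with
    | mem F hF =>
      obtain ⟨a, rfl⟩ := hF
      exact congrFun h a
    | zero => simp [gradAt, dotProduct]
    | add F G hF hG hF' hG' =>
      have hs : gradAt (F + G) x = gradAt F x + gradAt G x := by
        funext i; simp [gradAt]
      rw [hs, add_dotProduct, hF', hG', add_zero]
    | smul p F hF hF' =>
      have h0 : eval x F = 0 := mem_idealOf_iff.1 (hf ▸ hF) x hx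
      have hs : gradAt (p • F) x = eval x p • gradAt F x := by
        funext i; simp [gradAt, h0]
      rw [hs, smul_dotProduct, hF', smul_zero]

theorem rank_borderedHessian_map_evalPoint (hf : Ideal.span (Set.range f) = idealOf X)
    {x : Vec K N} (hx : x ∈ coneOf X) (μ : τ → K) :
    ((borderedHessian (idealOf X) f).map (evalPoint hx μ)).rank = 2 * (jacobianAt f x).rank +
      Module.finrank K
        (LinearMap.range (restrictForm (tangentSpace X x) (hessAt (linComb f μ) x))) := by
  have h : (borderedHessian (idealOf X) f).map (evalPoint hx μ) =
      Matrix.fromBlocks (hessAt (linComb f μ) x) (jacobianAt f x).transpose (jacobianAt f x) 0 := by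
    rw [borderedHessian, Matrix.fromBlocks_map, hessian_map_evalPoint, Matrix.transpose_map,
      jacobian_map_evalPoint]
    congr 1
  rw [h, Matrix.rank_fromBlocks_transpose,
    Matrix.finrank_map_coprod_transpose _ _ _ (mem_tangentSpace_iff_jacobianAt hf hx)
      (restrictForm (tangentSpace X x) (hessAt (linComb f μ) x)) fun _ _ => rfl]
  ring

omit [Fintype τ] in
theorem rank_jacobianAt_add_finrank (hf : Ideal.span (Set.range f) = idealOf X) {x : Vec K N}
    (hx : x ∈ coneOf X) :
    (jacobianAt f x).rank + Module.finrank K (tangentSpace X x) = N + 1 := by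
  have h : tangentSpace X x = LinearMap.ker (jacobianAt f x).mulVecLin :=
    Submodule.ext (mem_tangentSpace_iff_jacobianAt hf hx)
  rw [h, Matrix.rank, LinearMap.finrank_range_add_finrank_ker, Module.finrank_fintype_fun_eq_card,
    Fintype.card_fin]

/-- Every hyperplane through `T_x` is the differential of some `∑ μ_a f_a`: a covector vanishing on
`ker J` lies in the row space of `J`. -/
theorem exists_le_rank_of_isNonsingularAt (hf : Ideal.span (Set.range f) = idealOf X)
    {x : Vec K N} (hx : x ∈ coneOf X) (hxT : HasTangentFields X x)
    {ξ : Module.Dual K (Vec K N ⧸ tangentSpace X x)} (h : IsNonsingularAt X x ξ) :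
    ∃ μ : τ → K, gaussRank X ≤ Module.finrank K
      (LinearMap.range (restrictForm (tangentSpace X x) (hessAt (linComb f μ) x))) := by
  classical
  let w : Vec K N := fun i => ξ (Submodule.Quotient.mk (Pi.single i 1))
  have hw : ∀ z : Vec K N, ξ (Submodule.Quotient.mk z) = w ⬝ᵥ z := fun z => by
    have : (ξ.comp (tangentSpace X x).mkQ) = dotProductBilin K K w := by
      refine LinearMap.pi_ext' fun i => LinearMap.ext_ring ?_
      simp [w]
    exact LinearMap.congr_fun this z
  obtain ⟨μ, hμ⟩ := Matrix.exists_transpose_mulVec_eq (jacobianAt f x) w fun u hu => by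
    rw [← hw, (Submodule.Quotient.mk_eq_zero _).2
      ((mem_tangentSpace_iff_jacobianAt hf hx u).2 hu), map_zero]
  refine ⟨μ, ?_⟩
  have hξ : ∀ z, ξ (Submodule.Quotient.mk z) = gradAt (linComb f μ) x ⬝ᵥ z := fun z => by
    rw [gradAt_linComb, hμ, hw]
  have := gaussRank_le_of_isNonsingularAt h
  rwa [secondFundamentalForm_eq hxT (linComb_mem hf μ) hξ, LinearMap.range_neg] at this

end DualVar

end

/-! ### Homogeneity: independence of the coordinate vector. -/

noncomputable section

/-- The rows of a nonvanishing minor of maximal size already cut out the whole kernel. -/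
theorem Matrix.mulVec_eq_zero_of_submatrix {F m n : Type*} [Field F] [Fintype m] [Fintype n]
    (J : Matrix m n F) (r : Fin J.rank → m) (c : Fin J.rank → n) (h : (J.submatrix r c).det ≠ 0)
    {v : n → F} (hv : (J.submatrix r id).mulVec v = 0) : J.mulVec v = 0 := by
  have hle : LinearMap.ker J.mulVecLin ≤ LinearMap.ker (J.submatrix r id).mulVecLin :=
    fun w hw => funext fun k => congrFun hw (r k)
  have h1 : Module.finrank F (LinearMap.range J.mulVecLin) ≤
      Module.finrank F (LinearMap.range (J.submatrix r id).mulVecLin) :=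
    (J.submatrix r id).le_rank_of_det_submatrix_ne_zero id c h
  have h2 := J.mulVecLin.finrank_range_add_finrank_ker
  have h3 := (J.submatrix r id).mulVecLin.finrank_range_add_finrank_ker
  have h4 := Submodule.finrank_mono hle
  have heq := Submodule.eq_of_le_of_finrank_eq hle (by omega)
  have hmem : v ∈ LinearMap.ker (J.submatrix r id).mulVecLin := hv
  rw [← heq] at hmem
  exact hmem

namespace DualVar

open ConormalVariety

variable {K : Type*} [Field K] {N : ℕ} {X : Set (PSpace K N)}

theorem smul_mem_coneOf {t : K} (ht : t ≠ 0) {x : Vec K N} (hx : x ∈ coneOf X) :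
    t • x ∈ coneOf X := by
  obtain ⟨hx0, hxX⟩ := hx
  refine ⟨smul_ne_zero ht hx0, ?_⟩
  rwa [(Projectivization.mk_eq_mk_iff' K _ _ _ hx0).2 ⟨t, rfl⟩]

/-- Substitution of `t x` for `x` in a polynomial. -/
def scale (t : K) : MvPolynomial (Fin (N + 1)) K →ₐ[K] MvPolynomial (Fin (N + 1)) K :=
  aeval fun i => C t * MvPolynomial.X i

theorem eval_scale (t : K) (F : MvPolynomial (Fin (N + 1)) K) (x : Vec K N) :
    eval x (scale t F) = eval (t • x) F := by
  induction F using MvPolynomial.induction_on with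
  | C a => simp [scale]
  | add p q hp hq => simp [hp, hq]
  | mul_X p i hp =>
    rw [map_mul, map_mul, map_mul, hp]
    simp [scale]

theorem scale_mem_idealOf {t : K} (ht : t ≠ 0) {F : MvPolynomial (Fin (N + 1)) K}
    (hF : F ∈ idealOf X) : scale t F ∈ idealOf X := by
  rw [mem_idealOf_iff] at hF ⊢
  intro y hy
  rw [eval_scale]
  exact hF _ (smul_mem_coneOf ht hy)

theorem pderiv_scale (t : K) (i : Fin (N + 1)) (F : MvPolynomial (Fin (N + 1)) K) :
    pderiv i (scale t F) = C t * scale t (pderiv i F) := by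
  classical
  induction F using MvPolynomial.induction_on with
  | C a => simp [scale]
  | add p q hp hq => simp [hp, hq, mul_add]
  | mul_X p j hp =>
    have hX : scale t (MvPolynomial.X j) = C t * MvPolynomial.X (R := K) j := by simp [scale]
    rw [map_mul, Derivation.leibniz, Derivation.leibniz, hp, hX]
    by_cases h : j = i
    · subst h
      simp [hX]
      ring
    · simp [pderiv_X, h, hX]
      ring

theorem gradAt_scale (t : K) (F : MvPolynomial (Fin (N + 1)) K) (x : Vec K N) :
    gradAt (scale t F) x = t • gradAt F (t • x) := by
  funext i
  simp [gradAt, pderiv_scale, eval_scale]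

theorem hessAt_scale (t : K) (F : MvPolynomial (Fin (N + 1)) K) (x : Vec K N) :
    hessAt (scale t F) x = (t * t) • hessAt F (t • x) := by
  ext i j
  simp [hessAt, pderiv_scale, eval_scale, mul_assoc]

theorem tangentSpace_le_smul {t : K} (ht : t ≠ 0) (x : Vec K N) :
    tangentSpace X x ≤ tangentSpace X (t • x) := by
  intro w hw
  rw [mem_tangentSpace_iff] at hw ⊢
  intro F hF
  have h := hw _ (scale_mem_idealOf ht hF)
  rw [gradAt_scale, smul_dotProduct, smul_eq_mul] at h
  exact (mul_eq_zero.1 h).resolve_left ht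

theorem tangentSpace_smul {t : K} (ht : t ≠ 0) (x : Vec K N) :
    tangentSpace X (t • x) = tangentSpace X x := by
  refine le_antisymm ?_ (tangentSpace_le_smul ht x)
  have h := tangentSpace_le_smul (X := X) (inv_ne_zero ht) (t • x)
  rwa [inv_smul_smul₀ ht] at h

theorem smul_mem_smoothLocus {t : K} (ht : t ≠ 0) {x : Vec K N} (hx : x ∈ smoothLocus X) :
    t • x ∈ smoothLocus X :=
  ⟨smul_mem_coneOf ht hx.1, by rw [tangentSpace_smul ht]; exact hx.2⟩

theorem subset_zariskiClosure (Y : Set (PSpace K N)) : Y ⊆ zariskiClosure Y := by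
  intro p hp F hF
  refine mem_idealOf_iff.1 hF _ ⟨p.rep_nonzero, ?_⟩
  rwa [p.mk_rep]

theorem idealOf_zariskiClosure (Y : Set (PSpace K N)) :
    idealOf (zariskiClosure Y) = idealOf Y := by
  refine le_antisymm (fun F hF => ?_) (fun F hF => ?_)
  · rw [mem_idealOf_iff] at hF ⊢
    exact fun y hy => hF y ⟨hy.1, subset_zariskiClosure Y hy.2⟩
  · rw [mem_idealOf_iff]
    rintro y ⟨hy0, hy⟩
    obtain ⟨t, ht⟩ := Projectivization.exists_smul_eq_mk_rep K y hy0
    have h := hy _ (scale_mem_idealOf (inv_ne_zero t.ne_zero) hF)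
    rw [eval_scale, ← ht] at h
    rwa [Units.smul_def, inv_smul_smul₀ t.ne_zero] at h

theorem mem_coneOf_tangentHyperplanes {ξ : Vec K N} :
    ξ ∈ coneOf (tangentHyperplanes X) ↔
      ξ ≠ 0 ∧ ∃ x ∈ smoothLocus X, ∀ w ∈ tangentSpace X x, ξ ⬝ᵥ w = 0 := by
  have key : ∀ hξ : ξ ≠ 0, ∀ w, (Projectivization.mk K ξ hξ).rep ⬝ᵥ w = 0 ↔ ξ ⬝ᵥ w = 0 :=
    fun hξ w => by
      obtain ⟨t, ht⟩ := Projectivization.exists_smul_eq_mk_rep K ξ hξ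
      rw [← ht, Units.smul_def, smul_dotProduct, smul_eq_mul, mul_eq_zero,
        or_iff_right t.ne_zero]
  constructor
  · rintro ⟨hξ, x, hx, h⟩
    exact ⟨hξ, x, hx, fun w hw => (key hξ w).1 (h w hw)⟩
  · rintro ⟨hξ, x, hx, h⟩
    exact ⟨hξ, x, hx, fun w hw => (key hξ w).2 (h w hw)⟩

/-- Replacing `F(x)` by `F(t x)` keeps it in `I(X)` and multiplies the Hessian by `t²`, while `T_x`
does not change. -/
theorem exists_isNonsingularAt_of_smul {τ : Type*} [Fintype τ]
    {f : τ → MvPolynomial (Fin (N + 1)) K} (hf : Ideal.span (Set.range f) = idealOf X)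
    (hT : ∀ x ∈ smoothLocus X, HasTangentFields X x) {t : K} (ht : t ≠ 0) {x : Vec K N}
    (hx : x ∈ smoothLocus X) (h : ∃ ξ, IsNonsingularAt X (t • x) ξ) :
    ∃ ξ, IsNonsingularAt X x ξ := by
  obtain ⟨ξ, hξ⟩ := h
  have htx := smul_mem_smoothLocus ht hx
  obtain ⟨μ, hμ⟩ := exists_le_rank_of_isNonsingularAt hf htx.1 (hT _ htx) hξ
  refine exists_isNonsingularAt (hT x hx) hx (scale_mem_idealOf ht (linComb_mem hf μ)) ?_
  have hs : ∀ T : Submodule K (Vec K N), restrictForm T (hessAt (scale t (linComb f μ)) x) =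
      (t * t) • restrictForm T (hessAt (linComb f μ) (t • x)) := fun T => by
    refine LinearMap.ext fun v => LinearMap.ext fun u => ?_
    rw [hessAt_scale, restrictForm_apply, Matrix.smul_mulVec, smul_dotProduct]
    rfl
  rw [hs, LinearMap.range_smul _ _ (mul_ne_zero ht ht)]
  rwa [tangentSpace_smul ht] at hμ

theorem eval_smul_of_isHomogeneous {F : MvPolynomial (Fin (N + 1)) K} {d : ℕ}
    (hF : F.IsHomogeneous d) (t : K) (x : Vec K N) : eval (t • x) F = t ^ d * eval x F := by
  rw [eval_eq', eval_eq', Finset.mul_sum]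
  refine Finset.sum_congr rfl fun e he => ?_
  have hd : ∑ i, e i = d := by
    have h1 : Finsupp.weight 1 e = d := hF (mem_support_iff.1 he)
    rw [← h1, ← Finsupp.degree_eq_sum, Finsupp.degree_eq_weight_one]
    rfl
  simp only [Pi.smul_apply, smul_eq_mul, mul_pow, Finset.prod_mul_distrib,
    Finset.prod_pow_eq_pow_sum, hd]
  ring

/-- Some homogeneous component of `g` is not in `I(X)`. Where it does not vanish, `t ↦ g(t x)` is a
nonzero polynomial, so `g(t x) ≠ 0` for some `t ≠ 0`. -/
theorem forGeneralSmoothPoint_of_smul [Infinite K] {P : Vec K N → Prop}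
    (hP : ∀ t : K, t ≠ 0 → ∀ x ∈ smoothLocus X, P (t • x) → P x)
    {g : MvPolynomial (Fin (N + 1)) K} (hg : g ∉ idealOf X)
    (h : ∀ x ∈ smoothLocus X, eval x g ≠ 0 → P x) : ForGeneralSmoothPoint X P := by
  obtain ⟨d, hdr, hd⟩ : ∃ d ∈ Finset.range (g.totalDegree + 1),
      homogeneousComponent d g ∉ idealOf X := by
    by_contra! hall
    apply hg
    rw [← sum_homogeneousComponent g]
    exact Ideal.sum_mem _ hall
  refine ⟨d, _, homogeneousComponent_isHomogeneous d g, hd, fun x hx hgx => ?_⟩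
  let q : Polynomial K := ∑ i ∈ Finset.range (g.totalDegree + 1),
    Polynomial.monomial i (eval x (homogeneousComponent i g))
  have hq : q ≠ 0 := fun h0 => hgx (by
    have := congrArg (fun p => Polynomial.coeff p d) h0
    simpa [q, Polynomial.finsetSum_coeff, Polynomial.coeff_monomial, Finset.mem_range.1 hdr]
      using this)
  have hqe : ∀ t, q.eval t = eval (t • x) g := fun t => by
    conv_rhs => rw [← sum_homogeneousComponent g]
    rw [map_sum, Polynomial.eval_finsetSum]
    refine Finset.sum_congr rfl fun i _ => ?_
    rw [Polynomial.eval_monomial, mul_comm]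
    exact (eval_smul_of_isHomogeneous (homogeneousComponent_isHomogeneous i g) t x).symm
  -- The extra factor forces `t ≠ 0`.
  obtain ⟨t, ht⟩ : ∃ t, (Polynomial.X * q).eval t ≠ 0 := by
    by_contra! hall
    exact mul_ne_zero Polynomial.X_ne_zero hq (Polynomial.funext fun t => by simp [hall t])
  rw [Polynomial.eval_mul, Polynomial.eval_X] at ht
  have ht0 := left_ne_zero_of_mul ht
  refine hP t ht0 x hx (h _ (smul_mem_smoothLocus ht0 hx) ?_)
  rw [← hqe]
  exact right_ne_zero_of_mul ht

end DualVar

end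

/-! ### Smooth points, tangent fields and the ideal of the dual variety. -/

noncomputable section

namespace DualVar

open ConormalVariety

variable {K : Type*} [Field K] {N : ℕ} {X : Set (PSpace K N)}

section

variable [CharZero K] [(idealOf X).IsPrime] {m : ℕ} {f : Fin m → MvPolynomial (Fin (N + 1)) K}

theorem mem_smoothLocus_iff_rank (hf : Ideal.span (Set.range f) = idealOf X) {x : Vec K N}
    (hx : x ∈ coneOf X) :
    x ∈ smoothLocus X ↔ (jacobianAt f x).rank = (genericJacobian (idealOf X) f).rank := by
  obtain ⟨d, -, hd, -, hJ, -⟩ := exists_ringKrullDim_eq_rank hf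
  have h := rank_jacobianAt_add_finrank hf hx
  rw [Fintype.card_fin] at hJ
  have hs : x ∈ smoothLocus X ↔ Module.finrank K (tangentSpace X x) = d := by
    change (_ ∧ _) ↔ _
    rw [and_iff_right hx, coneDim, hd]
    norm_cast
  rw [hs]
  omega

/-- Cramer's rule: at a smooth point some minor `Q` of the generic rank is nonzero, and it solves
the tangency equations polynomially. -/
theorem hasTangentFields_of_mem_smoothLocus (hf : Ideal.span (Set.range f) = idealOf X)
    {x : Vec K N} (hx : x ∈ smoothLocus X) : HasTangentFields X x := by
  intro w hw
  have hrank := (mem_smoothLocus_iff_rank hf hx.1).1 hx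
  obtain ⟨r, c, hdet⟩ := (jacobianAt f x).exists_det_submatrix_ne_zero hrank.ge
  let J : Matrix (Fin m) (Fin (N + 1)) (MvPolynomial (Fin (N + 1)) K) :=
    Matrix.of fun a i => pderiv i (f a)
  let Q := J.submatrix r c
  have hQ : eval x Q.det ≠ 0 := by
    have : ((J.map (eval x)).submatrix r c).det ≠ 0 := hdet
    rwa [Matrix.det_submatrix_map] at this
  let b : Fin (genericJacobian (idealOf X) f).rank → MvPolynomial (Fin (N + 1)) K :=
    (J.submatrix r id).mulVec fun i => C (w i)
  let u := Q.adjugate.mulVec b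
  let E : Matrix (Fin (N + 1)) (Fin (genericJacobian (idealOf X) f).rank)
      (MvPolynomial (Fin (N + 1)) K) := Matrix.of fun i k => if i = c k then 1 else 0
  -- The constant field `w`, scaled by `det Q`, is corrected in the columns `c` so that the
  -- equations of the rows `r` hold identically. The correction vanishes at `x` because `w` is
  -- tangent there.
  let W₀ : Fin (N + 1) → MvPolynomial (Fin (N + 1)) K := (Q.det • fun i => C (w i)) - E.mulVec u
  have hJE : (J.submatrix r id) * E = Q := by
    ext k k'
    simp [Matrix.mul_apply, E, Q]
  have hJW₀ : (J.submatrix r id).mulVec W₀ = 0 := by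
    rw [Matrix.mulVec_sub, Matrix.mulVec_smul, Matrix.mulVec_mulVec, hJE, Matrix.mulVec_mulVec,
      Matrix.mul_adjugate, Matrix.smul_mulVec, Matrix.one_mulVec, sub_self]
  have hbx : ∀ k, eval x (b k) = 0 := fun k => by
    have := congrFun ((mem_tangentSpace_iff_jacobianAt hf hx.1 w).1 hw) (r k)
    simpa [b, J, Matrix.mulVec, dotProduct, jacobianAt, gradAt] using this
  have hux : ∀ k, eval x (u k) = 0 := fun k => by
    simp [u, Matrix.mulVec, dotProduct, hbx]
  have hW₀x : ∀ i, eval x (W₀ i) = eval x Q.det * w i := fun i => by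
    simp [W₀, Matrix.mulVec, dotProduct, hux]
  -- As the size of `Q` is the generic rank, the remaining equations follow over the function field,
  -- hence modulo `I(X)`, hence at every point of `X`.
  have hJL : (genericJacobian (idealOf X) f).mulVec (fun i =>
      algebraMap (TotalRing (idealOf X) (Fin m)) (TotalField (idealOf X) (Fin m))
        (pullback (idealOf X) (Fin m) (W₀ i))) = 0 := by
    let φ : MvPolynomial (Fin (N + 1)) K →+* TotalField (idealOf X) (Fin m) :=
      (algebraMap (TotalRing (idealOf X) (Fin m)) (TotalField (idealOf X) (Fin m))).comp
        (pullback (idealOf X) (Fin m)).toRingHom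
    refine Matrix.mulVec_eq_zero_of_submatrix _ r c ?_ ?_
    · change ((J.map φ).submatrix r c).det ≠ 0
      rw [Matrix.det_submatrix_map]
      change algebraMap (TotalRing (idealOf X) (Fin m)) (TotalField (idealOf X) (Fin m))
        (pullback (idealOf X) (Fin m) Q.det) ≠ 0
      rw [Ne, algebraMap_totalField_eq_zero_iff, pullback_eq_zero_iff]
      exact fun h => hQ (mem_idealOf_iff.1 h x hx.1)
    · have h := congrArg (fun v k => φ (v k)) hJW₀
      funext k
      have hk := congrFun h k
      simp only [Matrix.mulVec, dotProduct, map_sum, map_mul, Pi.zero_apply, map_zero] at hk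
      exact hk
  have hW₀ : ∀ y ∈ coneOf X, fieldValue W₀ y ∈ tangentSpace X y := fun y hy => by
    rw [mem_tangentSpace_iff_jacobianAt hf hy]
    funext a
    have h := congrFun hJL a
    have hmem : ∑ i, pderiv i (f a) * W₀ i ∈ idealOf X := by
      rw [← pullback_eq_zero_iff (τ := Fin m),
        ← algebraMap_totalField_eq_zero_iff]
      simp only [map_sum, map_mul]
      exact h
    have := mem_idealOf_iff.1 hmem y hy
    simp only [map_sum, map_mul] at this
    exact this
  refine ⟨fun i => C (eval x Q.det)⁻¹ * W₀ i, ?_, fun y hy => ?_⟩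
  · funext i
    simp only [fieldValue, map_mul, eval_C, hW₀x]
    rw [inv_mul_cancel_left₀ hQ]
  · have : fieldValue (fun i => C (eval x Q.det)⁻¹ * W₀ i) y =
        (eval x Q.det)⁻¹ • fieldValue W₀ y := by
      funext i
      simp [fieldValue]
    rw [this]
    exact Submodule.smul_mem _ _ (hW₀ y hy)

/-- A hypersurface outside of which all points of `X` are smooth. -/
theorem exists_forall_mem_smoothLocus (hf : Ideal.span (Set.range f) = idealOf X) :
    ∃ g ∉ idealOf X, ∀ x ∈ coneOf X, eval x g ≠ 0 → x ∈ smoothLocus X := by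
  obtain ⟨s, hs, h⟩ := Matrix.exists_ne_zero_forall_le_rank_map (F := K) (jacobian (idealOf X) f)
    (algebraMap (TotalRing (idealOf X) (Fin m)) (TotalField (idealOf X) (Fin m))) le_rfl
  obtain ⟨g, hg, hgs⟩ := exists_evalPoint_ne_zero hs
  refine ⟨g, hg, fun x hx hgx => (mem_smoothLocus_iff_rank hf hx).2 ?_⟩
  obtain ⟨μ, hμ⟩ := hgs x hx hgx
  have h₁ := Matrix.rank_map_le_rank_map (jacobian (idealOf X) f)
    (algebraMap (TotalRing (idealOf X) (Fin m)) (TotalField (idealOf X) (Fin m)))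
    (algebraMap_totalField_injective _ _) (evalPoint hx μ)
  have h₂ := h _ hμ
  rw [jacobian_map_evalPoint] at h₁ h₂
  exact le_antisymm h₁ h₂

/-- Tangent hyperplanes at smooth points are values of the conormal map, and conversely its nonzero
values over smooth points are such hyperplanes. The assumption `hJ` ensures that the map is not
identically zero. -/
theorem idealOf_dualVariety (hf : Ideal.span (Set.range f) = idealOf X)
    (hJ : (genericJacobian (idealOf X) f).rank ≠ 0) :
    idealOf (dualVariety X) = RingHom.ker (aeval (covector (idealOf X) f) :
      MvPolynomial (Fin (N + 1)) K →ₐ[K] TotalRing (idealOf X) (Fin m)) := by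
  have hev : ∀ x (hx : x ∈ coneOf X) (μ : Fin m → K) (F : MvPolynomial (Fin (N + 1)) K),
      evalPoint hx μ (aeval (covector (idealOf X) f) F) = eval (gradAt (linComb f μ) x) F := by
    intro x hx μ F
    induction F using MvPolynomial.induction_on with
    | C a =>
      rw [eval_C, ← MvPolynomial.algebraMap_eq, AlgHom.commutes,
        ← (pullback (idealOf X) (Fin m)).commutes, evalPoint_pullback, MvPolynomial.algebraMap_eq,
        eval_C]
    | add p q hp hq => simp only [map_add, hp, hq]
    | mul_X p i hp => simp only [map_mul, hp, aeval_X, eval_X, evalPoint_covector]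
  rw [dualVariety, idealOf_zariskiClosure]
  ext F
  rw [RingHom.mem_ker, mem_idealOf_iff]
  constructor
  · intro hF
    obtain ⟨i, hi⟩ : ∃ i, covector (idealOf X) f i ≠ 0 := by
      by_contra! hall
      apply hJ
      have : genericJacobian (idealOf X) f = 0 := by
        ext a i
        have h := congrArg (coeff (Finsupp.single a 1)) (hall i)
        simp only [covector, pullback_apply, mul_comm (MvPolynomial.X _), coeff_sum, coeff_C_mul,
          coeff_X, coeff_zero, Finsupp.single_left_inj one_ne_zero, mul_ite, mul_one, mul_zero,
          Finset.sum_ite_eq', Finset.mem_univ, if_true] at h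
        change algebraMap _ _ (pullback (idealOf X) (Fin m) (pderiv i (f a))) = 0
        rw [pullback_apply, h, map_zero, map_zero]
      rw [this, Matrix.rank_zero]
    obtain ⟨g, hg, hgs⟩ := exists_forall_mem_smoothLocus hf
    by_contra hne
    have hgne : pullback (idealOf X) (Fin m) g ≠ 0 := fun h =>
      hg ((pullback_eq_zero_iff _ _).1 h)
    -- A point where this product is nonzero lies over a smooth `x`, has a nonzero covector and
    -- refutes `F = 0` on it.
    obtain ⟨g', hg', h'⟩ := exists_evalPoint_ne_zero (mul_ne_zero (mul_ne_zero hne hi) hgne)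
    obtain ⟨x, hx, hgx⟩ := exists_mem_coneOf_eval_ne_zero hg'
    obtain ⟨μ, hμ⟩ := h' x hx hgx
    rw [map_mul, map_mul, hev, evalPoint_covector, evalPoint_pullback] at hμ
    have hxs := hgs x hx (right_ne_zero_of_mul hμ)
    refine left_ne_zero_of_mul (left_ne_zero_of_mul hμ) (hF _ ?_)
    rw [mem_coneOf_tangentHyperplanes]
    refine ⟨fun h0 => right_ne_zero_of_mul (left_ne_zero_of_mul hμ) (congrFun h0 i), x, hxs,
      fun w hw => mem_tangentSpace_iff.1 hw _ (linComb_mem hf μ)⟩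
  · intro hF ξ hξ
    rw [mem_coneOf_tangentHyperplanes] at hξ
    obtain ⟨-, x, hx, hw⟩ := hξ
    obtain ⟨μ, hμ⟩ := Matrix.exists_transpose_mulVec_eq (jacobianAt f x) ξ fun u hu =>
      hw u ((mem_tangentSpace_iff_jacobianAt hf hx.1 u).2 hu)
    rw [← hμ, ← gradAt_linComb, ← hev x hx.1, hF, map_zero]

end

end DualVar

end

/-! ### The criterion. -/

open DualVar ConormalVariety in
theorem mainTheorem2 {K : Type*} [Field K] [CharZero K] {N : ℕ}
    (X : Set (DualVar.PSpace K N)) (hX : DualVar.IsVariety X)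
    (n r l : ℕ) (hn : DualVar.HasDim X n) (hnN : n < N)
    (hr : DualVar.gaussRank X = r) (hrn : r < n) (hl : l = n - r) :
    (DualVar.HasDim (DualVar.dualVariety X) (N - l - 1) ↔
      DualVar.ForGeneralSmoothPoint X (fun x => ∃ ξ, DualVar.IsNonsingularAt X x ξ)) ∧
    (DualVar.HasDim (DualVar.dualVariety X) (N - l - 1) ↔
      ∃ x ∈ DualVar.smoothLocus X, ∃ ξ, DualVar.IsNonsingularAt X x ξ) := by
  have := hX.irreducible
  obtain ⟨m, f, hf⟩ := Submodule.fg_iff_exists_fin_generating_family.1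
    (IsNoetherian.noetherian (idealOf X))
  replace hf : Ideal.span (Set.range f) = idealOf X := hf
  obtain ⟨d, e, hd, he, hJ, hM⟩ := exists_ringKrullDim_eq_rank hf
  rw [Fintype.card_fin] at hJ
  have hdn : d = n + 1 := by
    have h : coneDim X = (n : WithBot ℕ∞) + 1 := hn
    rw [coneDim, hd] at h
    exact_mod_cast h
  set c := (genericJacobian (idealOf X) f).rank with hc
  rw [← idealOf_dualVariety hf (by omega)] at he
  -- Here `c = N - n`, so `c + r = N - l`, the dimension of the cone over a variety of dimension `N
  -- - l - 1`. As `l ≤ n < N`, no subtraction is truncated.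
  have hdim : HasDim (dualVariety X) (N - l - 1) ↔ e = c + r := by
    change ringKrullDim _ = _ ↔ _
    rw [he]
    have : ((e : WithBot ℕ∞) = ((N - l - 1 : ℕ) : WithBot ℕ∞) + 1) ↔ e = N - l - 1 + 1 := by
      norm_cast
    rw [this]
    omega
  have hT : ∀ x ∈ smoothLocus X, HasTangentFields X x := fun x hx =>
    hasTangentFields_of_mem_smoothLocus hf hx
  have hrank : ∀ x (hx : x ∈ smoothLocus X) (μ : Fin m → K),
      ((borderedHessian (idealOf X) f).map (evalPoint hx.1 μ)).rank = 2 * c +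
      Module.finrank K
        (LinearMap.range (restrictForm (tangentSpace X x) (hessAt (linComb f μ) x))) :=
    fun x hx μ => by
      rw [rank_borderedHessian_map_evalPoint hf, (mem_smoothLocus_iff_rank hf hx.1).1 hx]
  obtain ⟨g₀, hg₀, hg₀s⟩ := exists_forall_mem_smoothLocus hf
  have hupper : e ≤ c + r := by
    obtain ⟨s, hs, h⟩ := Matrix.exists_ne_zero_forall_le_rank_map (F := K)
      (borderedHessian (idealOf X) f)
      (algebraMap (TotalRing (idealOf X) (Fin m)) (TotalField (idealOf X) (Fin m))) le_rfl
    obtain ⟨g, hg, hgs⟩ := exists_evalPoint_ne_zero hs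
    -- Since `I(X)` is prime, one point avoids both hypersurfaces: it is smooth and some `μ` attains
    -- the generic rank there.
    obtain ⟨x, hx, hgx⟩ := exists_mem_coneOf_eval_ne_zero (this.mul_notMem hg hg₀)
    rw [map_mul] at hgx
    have hxs := hg₀s x hx (right_ne_zero_of_mul hgx)
    obtain ⟨μ, hμ⟩ := hgs x hx (left_ne_zero_of_mul hgx)
    have h1 := h _ hμ
    rw [hrank x hxs, hM] at h1
    have h2 := finrank_range_restrictForm_le (hT x hxs) hxs (linComb_mem hf μ)
    omega
  have hgeneral : e = c + r → ForGeneralSmoothPoint X (fun x => ∃ ξ, IsNonsingularAt X x ξ) := by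
    intro heq
    obtain ⟨s, hs, h⟩ := Matrix.exists_ne_zero_forall_le_rank_map (F := K)
      (borderedHessian (idealOf X) f)
      (algebraMap (TotalRing (idealOf X) (Fin m)) (TotalField (idealOf X) (Fin m))) le_rfl
    obtain ⟨g, hg, hgs⟩ := exists_evalPoint_ne_zero hs
    refine forGeneralSmoothPoint_of_smul
      (fun t ht x hx => exists_isNonsingularAt_of_smul hf hT ht hx) hg fun x hx hgx => ?_
    obtain ⟨μ, hμ⟩ := hgs x hx.1 hgx
    have h1 := h _ hμ
    rw [hrank x hx, hM] at h1
    exact exists_isNonsingularAt (hT x hx) hx (linComb_mem hf μ) (by omega)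
  have hexists : ForGeneralSmoothPoint X (fun x => ∃ ξ, IsNonsingularAt X x ξ) →
      ∃ x ∈ smoothLocus X, ∃ ξ, IsNonsingularAt X x ξ := by
    rintro ⟨_, g, -, hg, h⟩
    obtain ⟨x, hx, hgx⟩ := exists_mem_coneOf_eval_ne_zero (this.mul_notMem hg hg₀)
    rw [map_mul] at hgx
    have hxs := hg₀s x hx (right_ne_zero_of_mul hgx)
    exact ⟨x, hxs, h x hxs (left_ne_zero_of_mul hgx)⟩
  have hlower : (∃ x ∈ smoothLocus X, ∃ ξ, IsNonsingularAt X x ξ) → e = c + r := by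
    rintro ⟨x, hx, ξ, hξ⟩
    obtain ⟨μ, hμ⟩ := exists_le_rank_of_isNonsingularAt hf hx.1 (hT x hx) hξ
    -- One nonsingular point suffices: specialization gives `2c + r ≤ c + e`, and `hupper` is the
    -- reverse inequality.
    have h1 := Matrix.rank_map_le_rank_map (borderedHessian (idealOf X) f)
      (algebraMap (TotalRing (idealOf X) (Fin m)) (TotalField (idealOf X) (Fin m)))
      (algebraMap_totalField_injective _ _) (evalPoint hx.1 μ)
    rw [hrank x hx, hM] at h1
    omega
  rw [hdim]
  exact ⟨⟨hgeneral, fun h => hlower (hexists h)⟩, fun h => hexists (hgeneral h), hlower⟩
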